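/- **Setting.** Let $(V,d)$ be a metric space with $d(u,v)\ge 1$ for all $u\ne v$, viewed as a complete graph with edge lengths $d$. In the *online Steiner network problem with edge duplication*, requests $(s_i,t_i,R_i)$ arrive one by one, where $s_i\neq t_i$ are in $V$ and $R_i\ge 1$ is an integer. The algorithm maintains a multigraph $H$ on $V$, from which no edge may ever be removed, such that after each step $H$ contains $R_i$ edge-disjoint $s_i$–$t_i$ paths for every request $i$ that has arrived (several copies of an edge may be bought). The cost $c(H)$ is the sum of the lengths of the edges of $H$, counted with multiplicity. At each step the algorithm knows only the requirements that have arrived and the distances between the terminals (endpoints of requests) that have arrived. Let $X$ be the set of all terminals, $k=|X|$, and let $\mathrm{OPT}$ be the least cost of a multigraph on $V$ that contains $R_i$ edge-disjoint $s_i$–$t_i$ paths for every $i$. **The algorithm.** *Steiner forest (Berman–Coulston).* When a pair $(s,t)$ arrives, $s$ and $t$ are given class $\lfloor\log_2 d(s,t)\rfloor$ (a vertex that occurs in several pairs has the class of each of these occurrences). For each level $j=0,\dots,\lfloor \log_2 d(s,t)\rfloor$ in turn, for $u=s$ and then $u=t$, go through all arrived terminals $v$ (including $s,t$) of class at least $j$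 with $d(u,v)<2^{j+1}$ and buy the edge $(u,v)$ unless $u$ and $v$ are already connected by bought edges. *Steiner network.* For every $\ell\ge 0$ run one instance of this algorithm; a request with $R_i\in[2^\ell,2^{\ell+1})$ is passed to the $\ell$-th instance, and $2^{\ell+1}$ copies are bought of each edge that this instance buys in response. **HST embeddings.** An *HST embedding* $T$ of $(X,d)$ is a finite rooted tree whose leaves are exactly the terminals $X$ and whose edge lengths are powers of $2$, such that (i) each node has the same distance to all its children; (ii) edge lengths decrease by a factor of $2$ from each edge to the next on every root-to-leaf path; (iii) if an edge has length $2^{j-1}$, then $d(x,y)<2^{j}$ for any two terminals $x,y$ that it separates from the root; and (iv) if the edges at the root have length $2^{j-1}$, then $d(x,y)\le 2^{j+1}$ for all $x,y\in X$. $\mathrm{OPT}(T)$ is the least cost of a multigraph consisting of copies of edges of $T$ that contains $R_i$ edge-disjoint $s_i$–$t_i$ paths for every $i$. **Theorem.** There is a deterministic $O(\log k)$-competitive online algorithm for the Steiner network problem with edge duplication, namely the algorithm above. Precisely, there is an absolute constant $C>0$ such that for all $(V,d)$ and all finite request sequences, the algorithm maintains a feasible multigraph after every step, its total cost is at most $C\log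 k\cdot \mathrm{OPT}$, and its total cost is at most $C\cdot\mathrm{OPT}(T)$ for every HST embedding $T$ of $(X,d)$. -/

import Mathlib

noncomputable section

namespace SteinerNetwork

/-! Multigraphs are multisets of unordered pairs: the multiplicity of a pair is the number of
copies of that edge. -/

/-- The multigraph `H` contains `r` edge-disjoint paths between `s` and `t`: there are `r` paths
which together use every edge at most as often as `H` has copies of it. -/
def HasDisjointPaths {W : Type*} (H : Multiset (Sym2 W)) (s t : W) (r : ℕ) : Prop :=
  ∃ P : Fin r → (⊤ : SimpleGraph W).Path s t,
    ∑ i, ((P i : (⊤ : SimpleGraph W).Walk s t).edges : Multiset (Sym2 W)) ≤ H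

/-- Total length of the edges of a multigraph, counted with multiplicity. -/
def cost {W : Type*} (len : Sym2 W → ℝ) (H : Multiset (Sym2 W)) : ℝ :=
  (H.map len).sum

/-- Edge lengths of the complete graph on a metric space. -/
def distLen {V : Type*} [MetricSpace V] : Sym2 V → ℝ :=
  Sym2.lift ⟨fun u v => dist u v, fun u v => dist_comm u v⟩

/-- A sequence of `n` requests: the `i`-th asks for `req i` edge-disjoint paths between
`src i` and `tgt i`. -/
structure Instance (V : Type*) where
  n : ℕ
  src : Fin n → V
  tgt : Fin n → V
  req : Fin n → ℕ
  src_ne_tgt : ∀ i, src i ≠ tgt i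
  req_pos : ∀ i, 1 ≤ req i

/-- The set of terminals. -/
def Instance.terminals {V : Type*} (I : Instance V) : Set V :=
  Set.range I.src ∪ Set.range I.tgt

/-- The number `k` of (distinct) terminals. -/
def Instance.k {V : Type*} (I : Instance V) : ℕ :=
  I.terminals.ncard

/-- Offline optimum: the least cost of a multigraph on `V` that satisfies all requests. Vertices
of `V` that are not terminals may be used. -/
def Instance.opt {V : Type*} [MetricSpace V] (I : Instance V) : ℝ :=
  sInf {c : ℝ | ∃ H : Multiset (Sym2 V),
    (∀ i, HasDisjointPaths H (I.src i) (I.tgt i) (I.req i)) ∧ c = cost distLen H}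

/-! ### Online algorithms -/

/-- Names for the endpoints of `m` requests: `inl i` is the source and `inr i` the target of the
`i`-th request. -/
abbrev Slot (m : ℕ) : Type := Fin m ⊕ Fin m

/-- A deterministic online algorithm. When request number `m` arrives (counting from `0`), it sees
the distances between the endpoints of the requests `0, …, m` and the requirements of these
requests, and nothing else about the graph. It answers with the multiset of edges that it buys
at this step; edges bought earlier can never be given back. -/
def OnlineAlgorithm : Type :=
  (m : ℕ) → (d : Slot (m + 1) → Slot (m + 1) → ℝ) → (R : Fin (m + 1) → ℕ) →
    Multiset (Sym2 (Slot (m + 1)))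

/-- The vertex named by a slot at the time when request `i` has arrived. -/
def Instance.vertex {V : Type*} (I : Instance V) (i : Fin I.n) : Slot (i.val + 1) → V :=
  Sum.elim (fun a => I.src (Fin.castLE i.isLt a)) (fun a => I.tgt (Fin.castLE i.isLt a))

/-- The edges that `A` buys when request `i` arrives. -/
def Instance.bought {V : Type*} [MetricSpace V] (I : Instance V) (A : OnlineAlgorithm)
    (i : Fin I.n) : Multiset (Sym2 V) :=
  (A i.val (fun p q => dist (I.vertex i p) (I.vertex i q))
    (fun a => I.req (Fin.castLE i.isLt a))).map (Sym2.map (I.vertex i))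

/-- The multigraph that `A` maintains, after request `i` has been served. -/
def Instance.solutionAt {V : Type*} [MetricSpace V] (I : Instance V) (A : OnlineAlgorithm)
    (i : Fin I.n) : Multiset (Sym2 V) :=
  ∑ j ∈ Finset.Iic i, I.bought A j

/-- After every step, the multigraph maintained by `A` satisfies all requests that have arrived. -/
def Instance.Maintains {V : Type*} [MetricSpace V] (I : Instance V) (A : OnlineAlgorithm) : Prop :=
  ∀ i j : Fin I.n, j ≤ i →
    HasDisjointPaths (I.solutionAt A i) (I.src j) (I.tgt j) (I.req j)

/-- The total cost of `A` on the whole request sequence. -/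
def Instance.algCost {V : Type*} [MetricSpace V] (I : Instance V) (A : OnlineAlgorithm) : ℝ :=
  cost distLen (∑ i, I.bought A i)

/-! ### The Berman–Coulston algorithm for online Steiner forest

It works with a set `P` of names of points and the distances `d` between the points they name;
two names at distance `0` stand for the same vertex. -/

/-- `x` and `y` are already connected by the bought edges `H`. -/
def Linked {P : Type*} (d : P → P → ℝ) (H : Multiset (Sym2 P)) : P → P → Prop :=
  Relation.ReflTransGen (fun x y => d x y = 0 ∨ s(x, y) ∈ H)

open scoped Classical in
/-- Go through the list and buy the edge from `u` to each `v` not yet connected to `u`. -/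
def connect {P : Type*} (d : P → P → ℝ) (u : P) (vs : List P) (H : Multiset (Sym2 P)) :
    Multiset (Sym2 P) :=
  vs.foldl (fun K v => if Linked d K u v then K else s(u, v) ::ₘ K) H

/-- The class of both endpoints of a pair. -/
def pairClass {P : Type*} (d : P → P → ℝ) (r : P × P) : ℕ :=
  ⌊Real.logb 2 (d r.1 r.2)⌋₊

open scoped Classical in
/-- The terminals of class at least `j` at distance less than `2 ^ (j + 1)` from `u`, among the
endpoints of the pairs in `rs`. -/
def candidates {P : Type*} (d : P → P → ℝ) (rs : List (P × P)) (u : P) (j : ℕ) : List P :=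
  ((rs.filter (fun r => j ≤ pairClass d r)).flatMap (fun r => [r.1, r.2])).filter
    (fun v => d u v < 2 ^ (j + 1))

/-- Level `j` of the iteration for the pair `r`; `rs` are the arrived pairs, including `r`. -/
def level {P : Type*} (d : P → P → ℝ) (rs : List (P × P)) (r : P × P)
    (H : Multiset (Sym2 P)) (j : ℕ) : Multiset (Sym2 P) :=
  connect d r.2 (candidates d rs r.2 j) (connect d r.1 (candidates d rs r.1 j) H)

/-- The edge set bought by the algorithm on a list of pairs, the most recent pair first. -/
def bermanCoulston {P : Type*} (d : P → P → ℝ) : List (P × P) → Multiset (Sym2 P)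
  | [] => 0
  | r :: past =>
      (List.range (pairClass d r + 1)).foldl (level d (r :: past) r) (bermanCoulston d past)

/-! ### The Steiner network algorithm -/

/-- The pairs among the first `m` requests whose requirement lies in `[2 ^ l, 2 ^ (l + 1))`, most
recent first. -/
def scalePairs {m : ℕ} (R : Fin m → ℕ) (l : ℕ) : List (Slot m × Slot m) :=
  ((List.finRange m).reverse.filter (fun i => Nat.log 2 (R i) = l)).map
    (fun i => (Sum.inl i, Sum.inr i))

open scoped Classical in
/-- A pair with requirement in `[2 ^ l, 2 ^ (l + 1))` is passed to the `l`-th instance of the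
Berman–Coulston algorithm, and `2 ^ (l + 1)` copies are bought of each edge that this instance
buys in response. -/
def networkAlgorithm : OnlineAlgorithm := fun m d R =>
  2 ^ (Nat.log 2 (R (Fin.last m)) + 1) •
    (bermanCoulston d (scalePairs R (Nat.log 2 (R (Fin.last m)))) -
      bermanCoulston d (scalePairs R (Nat.log 2 (R (Fin.last m)))).tail)

/-! ### HST embeddings -/

/-- `w` is a child of `v` in the tree `G` rooted at `root`. -/
def IsChild {N : Type*} (G : SimpleGraph N) (root v w : N) : Prop :=
  G.Adj v w ∧ G.dist root w = G.dist root v + 1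

/-- `x` lies in the subtree below `w`, that is, `w` lies on the path from `root` to `x`. -/
def IsBelow {N : Type*} (G : SimpleGraph N) (root w x : N) : Prop :=
  G.dist root x = G.dist root w + G.dist w x

/-- A hierarchically separated tree embedding of the terminal set `X`. An edge of length
`2 ^ (j - 1)` has level `j`. Instead of one fixed height, the tree only has to be tall enough:
the top level `j`, that of the edges at the root, satisfies `dist x y ≤ 2 ^ (j + 1)` for all
terminals. -/
structure HST {V : Type*} [MetricSpace V] (X : Set V) where
  Node : Type
  finite : Finite Node
  graph : SimpleGraph Node
  isTree : graph.IsTree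
  root : Node
  /-- The node of each terminal (values outside `X` play no role). -/
  leaf : V → Node
  /-- The leaves are exactly the terminals. -/
  leaf_bijOn : Set.BijOn leaf X {v | ∀ w, ¬ IsChild graph root v w}
  len : Sym2 Node → ℝ
  len_pow : ∀ e ∈ graph.edgeSet, ∃ j : ℤ, len e = 2 ^ (j - 1)
  /-- A node has the same distance to all its children. -/
  len_children : ∀ v w w', IsChild graph root v w → IsChild graph root v w' →
    len s(v, w) = len s(v, w')
  /-- Lengths halve from each edge to the next on the way down. -/
  len_halving : ∀ u v w, IsChild graph root u v → IsChild graph root v w →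
    len s(u, v) = 2 * len s(v, w)
  /-- The terminals cut off from the root by an edge of length `2 ^ (j - 1)` are pairwise at
  distance less than `2 ^ j`. -/
  diam_lt : ∀ v w, IsChild graph root v w → ∀ x ∈ X, ∀ y ∈ X,
    IsBelow graph root w (leaf x) → IsBelow graph root w (leaf y) →
      dist x y < 2 * len s(v, w)
  tall : ∀ w, IsChild graph root root w → ∀ x ∈ X, ∀ y ∈ X, dist x y ≤ 4 * len s(root, w)

/-- The optimum of the same requests on the tree `T`: the least cost of a multigraph that consists
of copies of edges of `T` and satisfies all requests. -/
def Instance.treeOpt {V : Type*} [MetricSpace V] (I : Instance V) (T : HST I.terminals) : ℝ :=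
  sInf {c : ℝ | ∃ H : Multiset (Sym2 T.Node), (∀ e ∈ H, e ∈ T.graph.edgeSet) ∧
    (∀ i, HasDisjointPaths H (T.leaf (I.src i)) (T.leaf (I.tgt i)) (I.req i)) ∧
      c = cost T.len H}

end SteinerNetwork

end

/-! The cost of the algorithm is compared with hierarchical clusterings: for every level `j`, a
partition of the terminals into clusters of diameter less than `2 ^ j`. The algorithm does not know
them, so the analysis may choose them to suit the solution it compares with.

One Berman–Coulston instance pays at most `2 ^ (j + 1)` for each level `j` and each cluster that
contains a terminal of class at least `j` (`potential_bermanCoulston_nonpos`,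
`cost_bermanCoulston_le`). An edge bought on level `j` is shorter than `2 ^ (j + 1)` and merges two
components that contain such terminals. Conversely, when a new terminal reaches level `j ≥ 1`, level
`j - 1` has already joined it to all of its level-`j` cluster, so it creates a new component only if
it opens a new cluster.

A request of class at least `j` has its endpoints at distance at least `2 ^ j`, hence in different
clusters. Any feasible multigraph therefore has at least `R_i` edges leaving the cluster of either
endpoint. At a fixed cluster the instances `l` that pay for it form a geometric sum, dominated by
the number of leaving edges; this gives `Instance.algCost_le_clusters`.

Against the optimum, the clusters are balls around the terminals, with one common order of the
centres on all levels and radii in `[2 ^ j / 4, 2 ^ j / 2)`. For a random order and random radii,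
the expected sum of `2 ^ j` over the levels that cut a given edge is at most a constant times its
length times the harmonic number of `k`; averaging fixes a good order and then good radii
(`exists_partitions`).

Against a tree embedding, the clusters are the terminal sets of subtrees. Only one tree edge leaves
a subtree, and its length is comparable to the sum of `2 ^ j` over all levels that use this subtree,
so no logarithm is lost. -/

noncomputable section

namespace SteinerNetwork

/-! ### Edge-disjoint paths and cuts -/

/-- The edge `e` has an endpoint inside `S` and one outside. -/
def Crosses {W : Type*} (S : Set W) (e : Sym2 W) : Prop :=
  (∃ a ∈ e, a ∈ S) ∧ ∃ b ∈ e, b ∉ S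

theorem crosses_compl {W : Type*} (S : Set W) : Crosses Sᶜ = Crosses S := by
  ext e
  simp [Crosses, and_comm]

-- Each path has a step across the boundary of `S`, and the edge multisets of the paths add up to at
-- most `H`.
open scoped Classical in
theorem HasDisjointPaths.le_countP_crosses {W : Type*} {H : Multiset (Sym2 W)} {s t : W} {r : ℕ}
    (h : HasDisjointPaths H s t r) {S : Set W} (hs : s ∈ S) (ht : t ∉ S) :
    r ≤ H.countP (Crosses S) := by
  obtain ⟨P, hP⟩ := h
  calc r = ∑ _i : Fin r, 1 := by simp
    _ ≤ ∑ i, Multiset.countP (Crosses S)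
          ((P i : (⊤ : SimpleGraph W).Walk s t).edges : Multiset (Sym2 W)) := by
        refine Finset.sum_le_sum fun i _ => ?_
        obtain ⟨d, hd, h1, h2⟩ := (P i : (⊤ : SimpleGraph W).Walk s t).exists_boundary_dart S hs ht
        refine Multiset.countP_pos.2 ⟨d.edge, ?_, ?_⟩
        · exact Multiset.mem_coe.2 (List.mem_map_of_mem hd)
        · exact ⟨⟨d.fst, by simp [SimpleGraph.Dart.edge], h1⟩,
            ⟨d.snd, by simp [SimpleGraph.Dart.edge], h2⟩⟩
    _ = Multiset.countP (Crosses S)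
          (∑ i, ((P i : (⊤ : SimpleGraph W).Walk s t).edges : Multiset (Sym2 W))) :=
        by simp only [← Multiset.coe_countPAddMonoidHom, map_sum]
    _ ≤ _ := Multiset.countP_le_of_le _ hP

open scoped Classical in
/-- A cut that separates `s` from `t` is crossed by at least as many edges as there are
edge-disjoint paths. -/
theorem HasDisjointPaths.le_countP_crosses_of_ne {W : Type*} {H : Multiset (Sym2 W)} {s t : W}
    {r : ℕ} (h : HasDisjointPaths H s t r) {S : Set W} (hst : ¬(s ∈ S ↔ t ∈ S)) :
    r ≤ H.countP (Crosses S) := by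
  by_cases hs : s ∈ S
  · exact h.le_countP_crosses hs (by tauto)
  · have := h.le_countP_crosses (S := Sᶜ) hs (by simp; tauto)
    simpa only [crosses_compl] using this

-- All `r` paths may be the same path: a path repeats no edge, so `r` copies of each of its edges
-- suffice.
open scoped Classical in
theorem hasDisjointPaths_of_reflTransGen {W : Type*} {H K : Multiset (Sym2 W)} {s t : W} {r : ℕ}
    (h : Relation.ReflTransGen (fun x y => x = y ∨ s(x, y) ∈ K) s t)
    (hK : ∀ e ∈ K, r ≤ H.count e) : HasDisjointPaths H s t r := by
  have hw : ∃ p : (⊤ : SimpleGraph W).Walk s t, ∀ e ∈ p.edges, e ∈ K := by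
    induction h with
    | refl => exact ⟨.nil, by simp⟩
    | @tail y z _ hyz ih =>
      obtain ⟨p, hp⟩ := ih
      by_cases hne : y = z
      · subst hne; exact ⟨p, hp⟩
      · refine ⟨p.concat (by simpa using hne), fun e he => ?_⟩
        rw [SimpleGraph.Walk.edges_concat, List.concat_eq_append, List.mem_append] at he
        rcases he with he | he
        · exact hp e he
        · rw [List.mem_singleton] at he
          subst he
          exact hyz.resolve_left hne
  obtain ⟨p, hp⟩ := hw
  refine ⟨fun _ => p.toPath, ?_⟩
  rw [Finset.sum_const, Finset.card_univ, Fintype.card_fin, Multiset.le_iff_count]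
  intro e
  rw [Multiset.count_nsmul]
  by_cases he : e ∈ (p.toPath : (⊤ : SimpleGraph W).Walk s t).edges
  · have h1 : Multiset.count e ((p.toPath : (⊤ : SimpleGraph W).Walk s t).edges :
        Multiset (Sym2 W)) ≤ 1 :=
      Multiset.nodup_iff_count_le_one.1
        (Multiset.coe_nodup.2 p.toPath.2.isTrail.edges_nodup) e
    calc _ ≤ r * 1 := Nat.mul_le_mul_left _ h1
      _ ≤ _ := by
        rw [mul_one]
        exact hK e (hp e (p.edges_toPath_subset_edges he))
  · rw [Multiset.count_eq_zero_of_notMem (by simpa using he)]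
    simp

/-! ### Costs of multigraphs -/

theorem cost_zero {W : Type*} (len : Sym2 W → ℝ) : cost len 0 = 0 := by simp [cost]

theorem cost_add {W : Type*} (len : Sym2 W → ℝ) (H K : Multiset (Sym2 W)) :
    cost len (H + K) = cost len H + cost len K := by simp [cost]

theorem cost_cons {W : Type*} (len : Sym2 W → ℝ) (e : Sym2 W) (H : Multiset (Sym2 W)) :
    cost len (e ::ₘ H) = len e + cost len H := by simp [cost]

theorem cost_nsmul {W : Type*} (len : Sym2 W → ℝ) (m : ℕ) (H : Multiset (Sym2 W)) :
    cost len (m • H) = m * cost len H := by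
  simp [cost, Multiset.map_nsmul, Multiset.sum_nsmul]

theorem cost_sum {W ι : Type*} (len : Sym2 W → ℝ) (s : Finset ι) (H : ι → Multiset (Sym2 W)) :
    cost len (∑ i ∈ s, H i) = ∑ i ∈ s, cost len (H i) := by
  classical
  induction s using Finset.induction_on with
  | empty => simp [cost_zero]
  | insert a s ha ih => rw [Finset.sum_insert ha, Finset.sum_insert ha, cost_add, ih]

@[simp] theorem distLen_mk {V : Type*} [MetricSpace V] (u v : V) : distLen s(u, v) = dist u v := rfl

/-! ### Components -/

theorem Linked.symm {P : Type*} {d : P → P → ℝ} (hd : ∀ x y, d x y = d y x)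
    {H : Multiset (Sym2 P)} {x y : P} (h : Linked d H x y) : Linked d H y x := by
  induction h with
  | refl => exact .refl
  | tail _ hab ih => exact .head (by rwa [hd, Sym2.eq_swap]) ih

theorem Linked.mono {P : Type*} {d : P → P → ℝ} {H K : Multiset (Sym2 P)} (hHK : H ≤ K) {x y : P}
    (h : Linked d H x y) : Linked d K x y :=
  Relation.ReflTransGen.mono (fun _ _ hab => Or.imp_right (Multiset.mem_of_le hHK) hab) _ _ h

/-- The components of the multigraph `H`. -/
def linkedSetoid {V : Type*} [MetricSpace V] (H : Multiset (Sym2 V)) : Setoid V where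
  r := Linked dist H
  iseqv := ⟨fun _ => .refl, fun h => h.symm dist_comm, fun h h' => h.trans h'⟩

open scoped Classical in
/-- The number of components of `H` that meet `S`. -/
def numComp {V : Type*} [MetricSpace V] (H : Multiset (Sym2 V)) (S : Finset V) : ℕ :=
  (S.image (Quotient.mk (linkedSetoid H))).card

-- Components of a larger multigraph are unions of components of a smaller one. Written as the image
-- under a map of quotients, this turns statements about numbers of components into statements about
-- injectivity.
open scoped Classical in
theorem image_component_of_le {V : Type*} [MetricSpace V] {H K : Multiset (Sym2 V)} (hHK : H ≤ K)
    (S : Finset V) : S.image (Quotient.mk (linkedSetoid K)) =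
      (S.image (Quotient.mk (linkedSetoid H))).image
        (Quotient.map' (s₁ := linkedSetoid H) (s₂ := linkedSetoid K) id
          fun _ _ h => Linked.mono hHK h) := by
  rw [Finset.image_image]
  rfl

theorem numComp_empty {V : Type*} [MetricSpace V] (H : Multiset (Sym2 V)) : numComp H ∅ = 0 := by
  simp [numComp]

theorem numComp_anti {V : Type*} [MetricSpace V] {H K : Multiset (Sym2 V)} (hHK : H ≤ K)
    (S : Finset V) : numComp K S ≤ numComp H S := by
  classical
  unfold numComp
  rw [image_component_of_le hHK]
  exact Finset.card_image_le

theorem numComp_cons_lt {V : Type*} [MetricSpace V] {H : Multiset (Sym2 V)} {S : Finset V} {u v : V}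
    (hu : u ∈ S) (hv : v ∈ S) (huv : ¬ Linked dist H u v) :
    numComp (s(u, v) ::ₘ H) S < numComp H S := by
  classical
  refine lt_of_le_of_ne (numComp_anti (Multiset.le_cons_self _ _) S) fun h => huv ?_
  unfold numComp at h
  rw [image_component_of_le (Multiset.le_cons_self H s(u, v)), Finset.card_image_iff] at h
  have heq : Quotient.mk (linkedSetoid H) u = Quotient.mk (linkedSetoid H) v := by
    refine h (Finset.mem_coe.2 (Finset.mem_image_of_mem (Quotient.mk (linkedSetoid H)) hu))
      (Finset.mem_coe.2 (Finset.mem_image_of_mem (Quotient.mk (linkedSetoid H)) hv)) ?_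
    refine Quotient.sound (s := linkedSetoid (s(u, v) ::ₘ H)) ?_
    exact Relation.ReflTransGen.single (Or.inr (Multiset.mem_cons_self _ _))
  exact Quotient.exact heq

open scoped Classical in
/-- Adding a point that is linked to all points of its cluster increases the number of components
by no more than the number of clusters. -/
theorem numComp_insert_sub_le {V α : Type*} [MetricSpace V] (H : Multiset (Sym2 V)) (κ : V → α)
    (S : Finset V) (u : V) (h : ∀ y ∈ S, κ u = κ y → Linked dist H u y) :
    (numComp H (insert u S) : ℝ) - ((insert u S).image κ).card ≤
      numComp H S - (S.image κ).card := by
  unfold numComp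
  rw [Finset.image_insert, Finset.image_insert]
  by_cases hu : κ u ∈ S.image κ
  · obtain ⟨y, hy, hyu⟩ := Finset.mem_image.1 hu
    have : Quotient.mk (linkedSetoid H) u ∈ S.image (Quotient.mk (linkedSetoid H)) := by
      rw [Finset.mem_image]
      exact ⟨y, hy, Quotient.sound (s := linkedSetoid H) ((h y hy hyu.symm).symm dist_comm)⟩
    rw [Finset.insert_eq_of_mem hu, Finset.insert_eq_of_mem this]
  · rw [Finset.card_insert_of_notMem hu]
    have := Finset.card_insert_le (Quotient.mk (linkedSetoid H) u)
      (S.image (Quotient.mk (linkedSetoid H)))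
    have h2 : ((insert (Quotient.mk (linkedSetoid H) u)
      (S.image (Quotient.mk (linkedSetoid H)))).card : ℝ) ≤
        (S.image (Quotient.mk (linkedSetoid H))).card + 1 := by exact_mod_cast this
    push_cast
    linarith

/-! ### The Berman–Coulston algorithm -/

theorem le_connect {P : Type*} (d : P → P → ℝ) (u : P) (vs : List P) (H : Multiset (Sym2 P)) :
    H ≤ connect d u vs H := by
  induction vs generalizing H with
  | nil => exact le_rfl
  | cons v vs ih =>
    refine le_trans ?_ (ih _)
    dsimp only
    split_ifs
    · exact le_rfl
    · exact Multiset.le_cons_self _ _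

theorem linked_connect {P : Type*} {d : P → P → ℝ} {u v : P} {vs : List P} (hv : v ∈ vs)
    (H : Multiset (Sym2 P)) : Linked d (connect d u vs H) u v := by
  induction vs generalizing H with
  | nil => simp at hv
  | cons w vs ih =>
    rcases List.mem_cons.1 hv with rfl | hv
    · refine Linked.mono (le_connect d u vs _) ?_
      dsimp only
      split_ifs with h
      · exact h
      · exact Relation.ReflTransGen.single (Or.inr (Multiset.mem_cons_self _ _))
    · exact ih hv _

theorem le_level {P : Type*} (d : P → P → ℝ) (rs : List (P × P)) (r : P × P)
    (H : Multiset (Sym2 P)) (j : ℕ) : H ≤ level d rs r H j :=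
  (le_connect d _ _ _).trans (le_connect d _ _ _)

theorem le_foldl_level {P : Type*} (d : P → P → ℝ) (rs : List (P × P)) (r : P × P)
    (H : Multiset (Sym2 P)) (l : List ℕ) : H ≤ l.foldl (level d rs r) H := by
  induction l generalizing H with
  | nil => exact le_rfl
  | cons j l ih => exact (le_level d rs r H j).trans (ih _)

theorem bermanCoulston_le_cons {P : Type*} (d : P → P → ℝ) (r : P × P) (rs : List (P × P)) :
    bermanCoulston d rs ≤ bermanCoulston d (r :: rs) :=
  le_foldl_level d _ r _ _

theorem mem_candidates {P : Type*} {d : P → P → ℝ} {rs : List (P × P)} {u v : P} {j : ℕ} :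
    v ∈ candidates d rs u j ↔
      (∃ r ∈ rs, j ≤ pairClass d r ∧ (v = r.1 ∨ v = r.2)) ∧ d u v < 2 ^ (j + 1) := by
  simp only [candidates, List.mem_filter, List.mem_flatMap, List.mem_cons, List.not_mem_nil,
    or_false, decide_eq_true_eq]
  simp only [and_assoc]

theorem linked_level {P : Type*} {d : P → P → ℝ} {rs : List (P × P)} {r : P × P} {u v : P} {j : ℕ}
    (hu : u = r.1 ∨ u = r.2) (hv : v ∈ candidates d rs u j) (H : Multiset (Sym2 P)) :
    Linked d (level d rs r H j) u v := by
  rcases hu with rfl | rfl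
  · exact Linked.mono (le_connect _ _ _ _) (linked_connect hv _)
  · exact linked_connect hv _

theorem pow_pairClass_le {P : Type*} {d : P → P → ℝ} {r : P × P} (h : 1 ≤ d r.1 r.2) :
    (2 : ℝ) ^ pairClass d r ≤ d r.1 r.2 := by
  have h0 : 0 ≤ Real.logb 2 (d r.1 r.2) := Real.logb_nonneg (by norm_num) h
  have h1 := Nat.floor_le h0
  rw [Real.le_logb_iff_rpow_le (by norm_num) (by linarith), Real.rpow_natCast] at h1
  exact h1

theorem lt_pow_pairClass {P : Type*} {d : P → P → ℝ} {r : P × P} (h : 1 ≤ d r.1 r.2) :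
    d r.1 r.2 < (2 : ℝ) ^ (pairClass d r + 1) := by
  have h1 := Nat.lt_floor_add_one (Real.logb 2 (d r.1 r.2))
  rw [Real.logb_lt_iff_lt_rpow (by norm_num) (by linarith)] at h1
  exact_mod_cast h1

/-- The two endpoints of the last pair are connected by the algorithm. -/
theorem linked_bermanCoulston_cons {P : Type*} {d : P → P → ℝ} {r : P × P} (h : 1 ≤ d r.1 r.2)
    (rs : List (P × P)) : Linked d (bermanCoulston d (r :: rs)) r.1 r.2 := by
  rw [bermanCoulston, List.range_succ, List.foldl_append]
  exact linked_level (Or.inl rfl)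
    (mem_candidates.2 ⟨⟨r, by simp, le_rfl, Or.inr rfl⟩, lt_pow_pairClass h⟩) _

theorem linked_bermanCoulston {P : Type*} {d : P → P → ℝ} {r : P × P} (h : 1 ≤ d r.1 r.2)
    {rs : List (P × P)} (hr : r ∈ rs) : Linked d (bermanCoulston d rs) r.1 r.2 := by
  induction rs with
  | nil => simp at hr
  | cons q rs ih =>
    rcases List.mem_cons.1 hr with rfl | hr
    · exact linked_bermanCoulston_cons h rs
    · exact (ih hr).mono (bermanCoulston_le_cons d q rs)

open scoped Classical in
/-- The terminals of class at least `j`. -/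
def highTerminals {V : Type*} [MetricSpace V] (rs : List (V × V)) (j : ℕ) : Finset V :=
  ((rs.filter (fun r => j ≤ pairClass dist r)).flatMap (fun r => [r.1, r.2])).toFinset

theorem mem_highTerminals {V : Type*} [MetricSpace V] {rs : List (V × V)} {j : ℕ} {v : V} :
    v ∈ highTerminals rs j ↔ ∃ r ∈ rs, j ≤ pairClass dist r ∧ (v = r.1 ∨ v = r.2) := by
  simp only [highTerminals, List.mem_toFinset, List.mem_filter, List.mem_flatMap, List.mem_cons,
    List.not_mem_nil, or_false, decide_eq_true_eq, and_assoc]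

open scoped Classical in
theorem highTerminals_cons_of_le {V : Type*} [MetricSpace V] {r : V × V} {rs : List (V × V)} {j : ℕ}
    (h : j ≤ pairClass dist r) :
    highTerminals (r :: rs) j = insert r.1 (insert r.2 (highTerminals rs j)) := by
  ext v
  simp only [mem_highTerminals, List.mem_cons, Finset.mem_insert]
  constructor
  · rintro ⟨q, rfl | hq, hj, h'⟩
    · tauto
    · exact Or.inr (Or.inr ⟨q, hq, hj, h'⟩)
  · rintro (rfl | rfl | ⟨q, hq, hj, h'⟩)
    · exact ⟨r, by simp [h]⟩
    · exact ⟨r, by simp [h]⟩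
    · exact ⟨q, Or.inr hq, hj, h'⟩

theorem highTerminals_cons_of_lt {V : Type*} [MetricSpace V] {r : V × V} {rs : List (V × V)} {j : ℕ}
    (h : pairClass dist r < j) : highTerminals (r :: rs) j = highTerminals rs j := by
  simp [highTerminals, h]

open scoped Classical in
/-- The cost of `H` plus, on every level, the price of the remaining components in excess of the
number of clusters. -/
def potential {V α : Type*} [MetricSpace V] (κ : ℕ → V → α) (K : ℕ) (S : ℕ → Finset V)
    (H : Multiset (Sym2 V)) : ℝ :=
  cost distLen H + ∑ j ∈ Finset.range K,
    2 ^ (j + 1) * ((numComp H (S j) : ℝ) - ((S j).image (κ j)).card)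

-- A bought edge costs less than `2 ^ (i + 1)` and removes at least one component from level `i`,
-- which releases that amount. On the other levels components can only merge.
open scoped Classical in
theorem potential_connect_le {V α : Type*} [MetricSpace V] (κ : ℕ → V → α) {K i : ℕ} (hi : i < K)
    {S : ℕ → Finset V} {u : V} (hu : u ∈ S i) {vs : List V}
    (hvs : ∀ v ∈ vs, v ∈ S i ∧ dist u v < 2 ^ (i + 1)) (H : Multiset (Sym2 V)) :
    potential κ K S (connect dist u vs H) ≤ potential κ K S H := by
  induction vs generalizing H with
  | nil => exact le_rfl
  | cons v vs ih =>
    refine (ih (fun w hw => hvs w (by simp [hw])) _).trans ?_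
    dsimp only
    split_ifs with h
    · exact le_rfl
    · obtain ⟨hv, hd⟩ := hvs v (by simp)
      unfold potential
      rw [cost_cons, distLen_mk, ← Finset.add_sum_erase _ _ (Finset.mem_range.2 hi),
        ← Finset.add_sum_erase (Finset.range K) _ (Finset.mem_range.2 hi)]
      have h1 : (numComp (s(u, v) ::ₘ H) (S i) : ℝ) + 1 ≤ numComp H (S i) := by
        exact_mod_cast numComp_cons_lt hu hv h
      have h2 := mul_le_mul_of_nonneg_left h1 (by positivity : (0 : ℝ) ≤ 2 ^ (i + 1))
      have h3 : ∀ j ∈ (Finset.range K).erase i,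
          (2 : ℝ) ^ (j + 1) * ((numComp (s(u, v) ::ₘ H) (S j) : ℝ) - ((S j).image (κ j)).card) ≤
            2 ^ (j + 1) * ((numComp H (S j) : ℝ) - ((S j).image (κ j)).card) := by
        intro j _
        have : (numComp (s(u, v) ::ₘ H) (S j) : ℝ) ≤ numComp H (S j) := by
          exact_mod_cast numComp_anti (Multiset.le_cons_self H s(u, v)) (S j)
        gcongr
      have h4 := Finset.sum_le_sum h3
      nlinarith

/-- If on every level `j` the terminals of one cluster are at distance less than `2 ^ j`, the
algorithm pays no more than `2 ^ (j + 1)` for each level `j` and each cluster that contains a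
terminal of class at least `j`, reduced by the price of the components that are left. -/
theorem potential_bermanCoulston_nonpos {V α : Type*} [MetricSpace V]
    (hsep : ∀ u v : V, u ≠ v → 1 ≤ dist u v) (κ : ℕ → V → α) (K : ℕ) (rs : List (V × V))
    (hK : ∀ r ∈ rs, pairClass dist r < K)
    (hκ : ∀ j, ∀ x ∈ highTerminals rs 0, ∀ y ∈ highTerminals rs 0, κ j x = κ j y →
      dist x y < 2 ^ j) :
    potential κ K (highTerminals rs) (bermanCoulston dist rs) ≤ 0 := by
  classical
  induction rs with
  | nil => simp [potential, bermanCoulston, cost_zero, highTerminals, numComp_empty]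
  | cons r rs ih =>
    have hsub : ∀ j, highTerminals rs j ⊆ highTerminals (r :: rs) j := by
      intro j x hx
      rw [mem_highTerminals] at hx ⊢
      obtain ⟨q, hq, h⟩ := hx
      exact ⟨q, by simp [hq], h⟩
    have hanti : ∀ j, highTerminals (r :: rs) j ⊆ highTerminals (r :: rs) 0 := by
      intro j x hx
      rw [mem_highTerminals] at hx ⊢
      obtain ⟨q, hq, _, h⟩ := hx
      exact ⟨q, hq, Nat.zero_le _, h⟩
    have ih' := ih (fun q hq => hK q (by simp [hq]))
      (fun j x hx y hy => hκ j x (hsub 0 hx) y (hsub 0 hy))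
    have hcK := hK r (by simp)
    -- The new pair enters the terminal set of level `i` only just before that level is processed.
    -- Before level `i`, the sets of the levels below `i` contain it and the others do not.
    have key : ∀ i ≤ pairClass dist r + 1,
        potential κ K (fun j => if j < i then highTerminals (r :: rs) j else highTerminals rs j)
          ((List.range i).foldl (level dist (r :: rs) r) (bermanCoulston dist rs)) ≤ 0 := by
      intro i
      induction i with
      | zero => intro _; simpa using ih'
      | succ i ihi =>
        intro hi
        have hic : i ≤ pairClass dist r := by omega
        refine le_trans ?_ (ihi (by omega))
        have hlink : ∀ u, (u = r.1 ∨ u = r.2) → ∀ y ∈ highTerminals (r :: rs) i, κ i u = κ i y →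
            Linked dist ((List.range i).foldl (level dist (r :: rs) r) (bermanCoulston dist rs))
              u y := by
          intro u hu y hy huy
          have hu' : u ∈ highTerminals (r :: rs) 0 :=
            mem_highTerminals.2 ⟨r, by simp, Nat.zero_le _, hu⟩
          have hd := hκ i u hu' y (hanti i hy) huy
          -- On level `0` clusters have diameter less than `1` and are single points. On level `k +
          -- 1` the cluster lies within distance `2 ^ (k + 1)`, which is the search radius of level
          -- `k`, already processed.
          cases i with
          | zero =>
            by_cases h : u = y
            · subst h; exact .refl
            · have := hsep u y h
              norm_num at hd
              linarith
          | succ k =>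
            rw [List.range_succ, List.foldl_append]
            refine linked_level hu (mem_candidates.2 ⟨?_, hd⟩) _
            obtain ⟨q, hq, h1, h2⟩ := mem_highTerminals.1 hy
            exact ⟨q, hq, by omega, h2⟩
        rw [List.range_succ, List.foldl_append]
        set H := (List.range i).foldl (level dist (r :: rs) r) (bermanCoulston dist rs)
        have hcand : ∀ u, ∀ v ∈ candidates dist (r :: rs) u i,
            v ∈ (if i < i + 1 then highTerminals (r :: rs) i else highTerminals rs i) ∧
              dist u v < 2 ^ (i + 1) := by
          intro u v hv
          rw [mem_candidates] at hv
          rw [if_pos (Nat.lt_succ_self i), mem_highTerminals]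
          exact hv
        have hmem : ∀ u, (u = r.1 ∨ u = r.2) →
            u ∈ (if i < i + 1 then highTerminals (r :: rs) i else highTerminals rs i) := by
          intro u hu
          rw [if_pos (Nat.lt_succ_self i), mem_highTerminals]
          exact ⟨r, by simp, hic, hu⟩
        refine le_trans (potential_connect_le κ (by omega) (hmem r.2 (Or.inr rfl)) (hcand r.2) _) ?_
        refine le_trans (potential_connect_le κ (by omega) (hmem r.1 (Or.inl rfl)) (hcand r.1) _) ?_
        unfold potential
        refine add_le_add le_rfl
          (Finset.sum_le_sum fun j _ => mul_le_mul_of_nonneg_left ?_ (by positivity))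
        dsimp only
        -- Only level `j = i` changes its terminal set; there both endpoints are inserted, each
        -- already linked to its cluster.
        rcases lt_trichotomy j i with hj | rfl | hj
        · rw [if_pos hj, if_pos (by omega : j < i + 1)]
        · rw [if_pos (Nat.lt_succ_self j), if_neg (lt_irrefl j)]
          rw [highTerminals_cons_of_le hic] at hlink ⊢
          exact (numComp_insert_sub_le H (κ j) _ r.1
            fun y hy => hlink r.1 (Or.inl rfl) y (by simp only [Finset.mem_insert] at hy ⊢; tauto)).trans
              (numComp_insert_sub_le H (κ j) _ r.2
                fun y hy => hlink r.2 (Or.inr rfl) y (by simp only [Finset.mem_insert]; tauto))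
        · rw [if_neg (by omega : ¬ j < i + 1), if_neg (by omega : ¬ j < i)]
    have hfin := key _ le_rfl
    rw [bermanCoulston]
    convert hfin using 2
    funext j
    split_ifs with h
    · rfl
    · exact highTerminals_cons_of_lt (by omega)

open scoped Classical in
theorem cost_bermanCoulston_le {V α : Type*} [MetricSpace V]
    (hsep : ∀ u v : V, u ≠ v → 1 ≤ dist u v) (κ : ℕ → V → α) (K : ℕ) (rs : List (V × V))
    (hK : ∀ r ∈ rs, pairClass dist r < K)
    (hκ : ∀ j, ∀ x ∈ highTerminals rs 0, ∀ y ∈ highTerminals rs 0, κ j x = κ j y →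
      dist x y < 2 ^ j) :
    cost distLen (bermanCoulston dist rs) ≤
      ∑ j ∈ Finset.range K, 2 ^ (j + 1) * (((highTerminals rs j).image (κ j)).card : ℝ) := by
  have h := potential_bermanCoulston_nonpos hsep κ K rs hK hκ
  unfold potential at h
  simp only [mul_sub, Finset.sum_sub_distrib] at h
  have h2 : 0 ≤ ∑ j ∈ Finset.range K,
      (2 : ℝ) ^ (j + 1) * (numComp (bermanCoulston dist rs) (highTerminals rs j) : ℝ) :=
    Finset.sum_nonneg fun j _ => by positivity
  linarith

/-! ### Names of points -/

/-- The algorithm works with names, several of which may denote one vertex. The zero-distance steps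
in `Linked` pass between such names, so connectivity is the same for names and for vertices. -/
theorem linked_map_iff {P V : Type*} [MetricSpace V] (f : P → V) (H : Multiset (Sym2 P)) {x y : P} :
    Linked dist (H.map (Sym2.map f)) (f x) (f y) ↔
      Linked (fun p q => dist (f p) (f q)) H x y := by
  constructor
  · intro h
    -- The induction must cover every name `q` of the vertex reached, since the next edge may have
    -- been bought under another name.
    have key : ∀ z, Relation.ReflTransGen
        (fun a b => dist a b = 0 ∨ s(a, b) ∈ H.map (Sym2.map f)) (f x) z →
        ∀ q, f q = z → Linked (fun p q => dist (f p) (f q)) H x q := by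
      intro z hz
      induction hz with
      | refl => exact fun q hq => .single (Or.inl (by simp [hq]))
      | @tail a b _ hab ih =>
        intro q hq
        rcases hab with hab | hab
        · exact ih q (by rw [hq, dist_eq_zero.1 hab])
        · obtain ⟨e, he, hfe⟩ := Multiset.mem_map.1 hab
          have hstep : ∀ p' q', s(p', q') ∈ H → f p' = a → f q' = b →
              Linked (fun p q => dist (f p) (f q)) H x q := fun p' q' h1 h2 h3 =>
            ((ih p' h2).tail (Or.inr h1)).tail (Or.inl (by simp [h3, hq]))
          induction e using Sym2.ind with
          | _ p' q' =>
            rw [Sym2.map_mk, Sym2.eq_iff] at hfe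
            rcases hfe with ⟨h1, h2⟩ | ⟨h1, h2⟩
            · exact hstep p' q' he h1 h2
            · exact hstep q' p' (by rwa [Sym2.eq_swap]) h2 h1
    exact key _ h _ rfl
  · intro h
    induction h with
    | refl => exact .refl
    | tail _ hab ih =>
      refine ih.tail (hab.imp_right fun h => ?_)
      rw [← Sym2.map_mk]
      exact Multiset.mem_map_of_mem _ h

theorem connect_map {P V : Type*} [MetricSpace V] (f : P → V) (u : P) (vs : List P)
    (H : Multiset (Sym2 P)) :
    (connect (fun p q => dist (f p) (f q)) u vs H).map (Sym2.map f) =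
      connect dist (f u) (vs.map f) (H.map (Sym2.map f)) := by
  induction vs generalizing H with
  | nil => rfl
  | cons v vs ih =>
    refine (ih _).trans ?_
    rw [List.map_cons]
    change _ = connect dist (f u) (vs.map f) _
    dsimp only
    congr 1
    rw [linked_map_iff]
    split_ifs
    · rfl
    · rw [Multiset.map_cons, Sym2.map_mk]

theorem candidates_map {P V : Type*} [MetricSpace V] (f : P → V) (rs : List (P × P)) (u : P)
    (j : ℕ) :
    (candidates (fun p q => dist (f p) (f q)) rs u j).map f =
      candidates dist (rs.map (Prod.map f f)) (f u) j := by
  unfold candidates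
  rw [List.filter_map, List.flatMap_map]
  have : ((fun v => decide (dist (f u) v < 2 ^ (j + 1))) ∘ f) =
    fun v => decide (dist (f u) (f v) < 2 ^ (j + 1)) := rfl
  have h2 : ((fun r : V × V => decide (j ≤ pairClass dist r)) ∘ Prod.map f f) =
    fun r => decide (j ≤ pairClass (fun p q => dist (f p) (f q)) r) := rfl
  rw [h2, ← this, ← List.filter_map, List.map_flatMap]
  rfl

theorem level_map {P V : Type*} [MetricSpace V] (f : P → V) (rs : List (P × P)) (r : P × P)
    (H : Multiset (Sym2 P)) (j : ℕ) :
    (level (fun p q => dist (f p) (f q)) rs r H j).map (Sym2.map f) =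
      level dist (rs.map (Prod.map f f)) (Prod.map f f r) (H.map (Sym2.map f)) j := by
  unfold level
  rw [connect_map, connect_map, candidates_map, candidates_map]
  rfl

theorem bermanCoulston_map {P V : Type*} [MetricSpace V] (f : P → V) (rs : List (P × P)) :
    (bermanCoulston (fun p q => dist (f p) (f q)) rs).map (Sym2.map f) =
      bermanCoulston dist (rs.map (Prod.map f f)) := by
  induction rs with
  | nil => rfl
  | cons r rs ih =>
    rw [List.map_cons, bermanCoulston, bermanCoulston, ← ih]
    change _ = (List.range (pairClass (fun p q => dist (f p) (f q)) r + 1)).foldl _ _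
    generalize bermanCoulston (fun p q => dist (f p) (f q)) rs = H
    generalize List.range (pairClass (fun p q => dist (f p) (f q)) r + 1) = l
    induction l generalizing H with
    | nil => rfl
    | cons j l ihl =>
      rw [List.foldl_cons, List.foldl_cons, ihl, level_map]
      rfl

/-! ### The Steiner network algorithm -/

/-- The pairs with requirement in `[2 ^ l, 2 ^ (l + 1))` among the first `m` requests, most recent
first. -/
def Instance.arrived {V : Type*} (I : Instance V) (l m : ℕ) (hm : m ≤ I.n) : List (V × V) :=
  ((List.finRange m).reverse.filter (fun i => Nat.log 2 (I.req (Fin.castLE hm i)) = l)).map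
    (fun i => (I.src (Fin.castLE hm i), I.tgt (Fin.castLE hm i)))

theorem Instance.mem_arrived {V : Type*} (I : Instance V) {l m : ℕ} {hm : m ≤ I.n} {r : V × V} :
    r ∈ I.arrived l m hm ↔
      ∃ i : Fin I.n, i.val < m ∧ Nat.log 2 (I.req i) = l ∧ r = (I.src i, I.tgt i) := by
  simp only [Instance.arrived, List.mem_map, List.mem_filter, List.mem_reverse, List.mem_finRange,
    true_and, decide_eq_true_eq]
  constructor
  · rintro ⟨i, h, rfl⟩
    exact ⟨Fin.castLE hm i, i.isLt, h, rfl⟩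
  · rintro ⟨i, hi, h, rfl⟩
    exact ⟨⟨i, hi⟩, h, rfl⟩

theorem Instance.arrived_succ {V : Type*} (I : Instance V) (l : ℕ) (i : Fin I.n) :
    I.arrived l (i.val + 1) i.isLt =
      if Nat.log 2 (I.req i) = l then (I.src i, I.tgt i) :: I.arrived l i.val i.isLt.le
      else I.arrived l i.val i.isLt.le := by
  unfold Instance.arrived
  rw [List.finRange_succ_last, List.reverse_append, List.reverse_singleton, List.singleton_append,
    List.filter_cons, ← List.map_reverse, List.filter_map]
  have hlast : Fin.castLE i.isLt (Fin.last i.val) = i := rfl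
  rw [hlast]
  by_cases h : Nat.log 2 (I.req i) = l
  · rw [if_pos (by simpa using h), if_pos h, List.map_cons, List.map_map]
    rfl
  · rw [if_neg (by simpa using h), if_neg h, List.map_map]
    rfl

theorem Instance.map_scalePairs {V : Type*} (I : Instance V) (l : ℕ) (i : Fin I.n) :
    (scalePairs (fun a => I.req (Fin.castLE i.isLt a)) l).map
      (Prod.map (I.vertex i) (I.vertex i)) = I.arrived l (i.val + 1) i.isLt := by
  unfold scalePairs Instance.arrived
  rw [List.map_map]
  rfl

theorem bermanCoulston_tail_le {P : Type*} (d : P → P → ℝ) (rs : List (P × P)) :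
    bermanCoulston d rs.tail ≤ bermanCoulston d rs := by
  cases rs with
  | nil => exact le_rfl
  | cons r rs => exact bermanCoulston_le_cons d r rs

/-- The algorithm buys the difference of two complete runs, with and without the newest pair. Runs
are monotone in the list, so the truncated subtraction is exact; the sum form makes the purchases
telescope. -/
theorem Instance.bought_add {V : Type*} [MetricSpace V] (I : Instance V) (i : Fin I.n) {l : ℕ}
    (hl : Nat.log 2 (I.req i) = l) :
    I.bought networkAlgorithm i +
        2 ^ (l + 1) • bermanCoulston dist (I.arrived l i.val i.isLt.le) =
      2 ^ (l + 1) • bermanCoulston dist (I.arrived l (i.val + 1) i.isLt) := by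
  classical
  have hlast : Nat.log 2 (I.req (Fin.castLE i.isLt (Fin.last i.val))) = l := hl
  have h1 := I.arrived_succ l i
  rw [if_pos hl, ← I.map_scalePairs] at h1
  have h2 := congrArg List.tail h1
  rw [List.tail_cons, ← List.map_tail] at h2
  rw [← h2, ← I.map_scalePairs, ← bermanCoulston_map, ← bermanCoulston_map]
  unfold Instance.bought networkAlgorithm
  dsimp only
  rw [hlast, Multiset.map_nsmul, ← nsmul_add, ← Multiset.map_add]
  congr 2
  exact tsub_add_cancel_of_le (bermanCoulston_tail_le _ _)

theorem Instance.sum_bought {V : Type*} [MetricSpace V] (I : Instance V) {L : ℕ}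
    (hL : ∀ i, Nat.log 2 (I.req i) < L) (m : ℕ) (hm : m ≤ I.n) :
    ∑ i : Fin I.n with i.val < m, I.bought networkAlgorithm i =
      ∑ l ∈ Finset.range L, 2 ^ (l + 1) • bermanCoulston dist (I.arrived l m hm) := by
  induction m with
  | zero => simp [Instance.arrived, bermanCoulston]
  | succ m ih =>
    have hm' : m < I.n := hm
    have hfilter : (Finset.univ.filter fun i : Fin I.n => i.val < m + 1) =
        insert ⟨m, hm'⟩ (Finset.univ.filter fun i : Fin I.n => i.val < m) := by
      ext i
      simp only [Finset.mem_filter, Finset.mem_univ, true_and, Finset.mem_insert, Fin.ext_iff]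
      omega
    rw [hfilter, Finset.sum_insert (by simp), ih hm'.le]
    -- Only the instance of the newest request's scale changes; all others keep their list of pairs.
    have hmem : Nat.log 2 (I.req ⟨m, hm'⟩) ∈ Finset.range L := Finset.mem_range.2 (hL _)
    rw [← Finset.add_sum_erase _ _ hmem, ← Finset.add_sum_erase (Finset.range L) _ hmem, ← add_assoc,
      I.bought_add ⟨m, hm'⟩ rfl]
    congr 1
    refine Finset.sum_congr rfl fun l hl => ?_
    have := I.arrived_succ l ⟨m, hm'⟩
    rw [if_neg (Finset.ne_of_mem_erase hl).symm] at this
    rw [this]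

theorem Instance.exists_log_lt {V : Type*} (I : Instance V) :
    ∃ L, ∀ i, Nat.log 2 (I.req i) < L := by
  obtain ⟨M, hM⟩ := (Set.finite_range fun i => Nat.log 2 (I.req i)).bddAbove
  exact ⟨M + 1, fun i => Nat.lt_succ_of_le (hM ⟨i, rfl⟩)⟩

theorem Instance.exists_pairClass_lt {V : Type*} [MetricSpace V] (I : Instance V) :
    ∃ K, ∀ i, pairClass dist (I.src i, I.tgt i) < K := by
  obtain ⟨M, hM⟩ := (Set.finite_range fun i => pairClass dist (I.src i, I.tgt i)).bddAbove
  exact ⟨M + 1, fun i => Nat.lt_succ_of_le (hM ⟨i, rfl⟩)⟩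

theorem Instance.maintains_networkAlgorithm {V : Type*} [MetricSpace V]
    (hsep : ∀ u v : V, u ≠ v → 1 ≤ dist u v) (I : Instance V) :
    I.Maintains networkAlgorithm := by
  classical
  intro i j hji
  obtain ⟨L, hL⟩ := I.exists_log_lt
  have hIic : Finset.Iic i = Finset.univ.filter fun a : Fin I.n => a.val < i.val + 1 := by
    ext a
    rw [Finset.mem_Iic, Finset.mem_filter, Fin.le_def, Nat.lt_succ_iff]
    simp
  unfold Instance.solutionAt
  rw [hIic, I.sum_bought hL (i.val + 1) i.isLt]
  set l := Nat.log 2 (I.req j) with hl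
  have hmem : (I.src j, I.tgt j) ∈ I.arrived l (i.val + 1) i.isLt :=
    I.mem_arrived.2 ⟨j, Nat.lt_succ_of_le hji, rfl, rfl⟩
  have hlink := linked_bermanCoulston (d := dist) (r := (I.src j, I.tgt j))
    (hsep _ _ (I.src_ne_tgt j)) hmem
  refine hasDisjointPaths_of_reflTransGen
    (K := bermanCoulston dist (I.arrived l (i.val + 1) i.isLt)) ?_ fun e he => ?_
  · exact Relation.ReflTransGen.mono (fun _ _ hab => hab.imp_left eq_of_dist_eq_zero) _ _ hlink
  · rw [Multiset.count_sum']
    have h1 : I.req j ≤ 2 ^ (l + 1) :=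
      (Nat.lt_pow_succ_log_self (by norm_num) _).le
    calc I.req j ≤ 2 ^ (l + 1) * 1 := by rwa [mul_one]
      _ ≤ 2 ^ (l + 1) * Multiset.count e (bermanCoulston dist (I.arrived l (i.val + 1) i.isLt)) :=
        Nat.mul_le_mul_left _ (Multiset.one_le_count_iff_mem.2 he)
      _ = Multiset.count e
          (2 ^ (l + 1) • bermanCoulston dist (I.arrived l (i.val + 1) i.isLt)) := by
        rw [Multiset.count_nsmul]
      _ ≤ _ := Finset.single_le_sum (f := fun l => Multiset.count e
          (2 ^ (l + 1) • bermanCoulston dist (I.arrived l (i.val + 1) i.isLt)))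
          (fun _ _ => Nat.zero_le _) (Finset.mem_range.2 (hL j))

theorem Instance.algCost_eq {V : Type*} [MetricSpace V] (I : Instance V) {L : ℕ}
    (hL : ∀ i, Nat.log 2 (I.req i) < L) :
    I.algCost networkAlgorithm =
      ∑ l ∈ Finset.range L, 2 ^ (l + 1) *
        cost distLen (bermanCoulston dist (I.arrived l I.n le_rfl)) := by
  have h := I.sum_bought hL I.n le_rfl
  have huniv : (Finset.univ.filter fun i : Fin I.n => i.val < I.n) = Finset.univ := by
    ext i
    simp
  rw [huniv] at h
  unfold Instance.algCost
  rw [h, cost_sum]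
  simp [cost_nsmul]

/-! ### Charging the algorithm to the capacities of clusters -/

theorem sum_two_pow_le_of_forall_le (s : Finset ℕ) (w : ℕ) (h : ∀ l ∈ s, 2 ^ l ≤ w) :
    ∑ l ∈ s, 2 ^ (l + 1) ≤ 4 * w := by
  rcases s.eq_empty_or_nonempty with rfl | ⟨a, ha⟩
  · simp
  have hw : w ≠ 0 := by
    have := h a ha
    have := Nat.two_pow_pos a
    omega
  have hgeom : ∀ m, ∑ l ∈ Finset.range m, 2 ^ (l + 1) + 2 = 2 ^ (m + 1) := by
    intro m
    induction m with
    | zero => simp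
    | succ m ih =>
      rw [Finset.sum_range_succ, pow_succ 2 (m + 1)]
      omega
  have hsub : s ⊆ Finset.range (Nat.log 2 w + 1) := fun l hl =>
    Finset.mem_range.2 (Nat.lt_succ_of_le (Nat.le_log_of_pow_le (by norm_num) (h l hl)))
  have h1 := Finset.sum_le_sum_of_subset (f := fun l => 2 ^ (l + 1)) hsub
  have h2 := hgeom (Nat.log 2 w + 1)
  have h3 := Nat.pow_log_le_self 2 hw
  have h4 : 2 ^ (Nat.log 2 w + 1 + 1) = 4 * 2 ^ Nat.log 2 w := by ring
  omega

open scoped Classical in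
/-- The terminals as a finite set. -/
def Instance.terminalFinset {V : Type*} (I : Instance V) : Finset V :=
  Finset.univ.image I.src ∪ Finset.univ.image I.tgt

theorem Instance.coe_terminalFinset {V : Type*} (I : Instance V) :
    (I.terminalFinset : Set V) = I.terminals := by
  simp [Instance.terminalFinset, Instance.terminals]

theorem Instance.card_terminalFinset {V : Type*} (I : Instance V) :
    I.terminalFinset.card = I.k := by
  rw [Instance.k, ← I.coe_terminalFinset, Set.ncard_coe_finset]

theorem Instance.src_mem {V : Type*} (I : Instance V) (i : Fin I.n) : I.src i ∈ I.terminals :=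
  Or.inl ⟨i, rfl⟩

theorem Instance.tgt_mem {V : Type*} (I : Instance V) (i : Fin I.n) : I.tgt i ∈ I.terminals :=
  Or.inr ⟨i, rfl⟩

open scoped Classical in
/-- The cost of the algorithm is bounded by the capacities of clusters, if the terminals are
partitioned on every level `j` into clusters of diameter less than `2 ^ j`. -/
theorem Instance.algCost_le_clusters {V α : Type*} [MetricSpace V]
    (hsep : ∀ u v : V, u ≠ v → 1 ≤ dist u v) (I : Instance V) (κ : ℕ → V → α) (w : ℕ → α → ℕ)
    {K : ℕ} (hK : ∀ i, pairClass dist (I.src i, I.tgt i) < K)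
    (hκ : ∀ j, ∀ x ∈ I.terminals, ∀ y ∈ I.terminals, κ j x = κ j y → dist x y < 2 ^ j)
    (hw : ∀ j i A, κ j (I.src i) ≠ κ j (I.tgt i) → (κ j (I.src i) = A ∨ κ j (I.tgt i) = A) →
      I.req i ≤ w j A) :
    I.algCost networkAlgorithm ≤
      8 * ∑ j ∈ Finset.range K, 2 ^ j * ∑ A ∈ I.terminalFinset.image (κ j), (w j A : ℝ) := by
  obtain ⟨L, hL⟩ := I.exists_log_lt
  have hsub : ∀ l j, highTerminals (I.arrived l I.n le_rfl) j ⊆ I.terminalFinset := by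
    intro l j x hx
    obtain ⟨r, hr, _, h⟩ := mem_highTerminals.1 hx
    obtain ⟨i, _, _, rfl⟩ := I.mem_arrived.1 hr
    rw [← Finset.mem_coe, I.coe_terminalFinset]
    rcases h with rfl | rfl
    · exact I.src_mem i
    · exact I.tgt_mem i
  have hterm : ∀ l j, ∀ x ∈ highTerminals (I.arrived l I.n le_rfl) j, x ∈ I.terminals := by
    intro l j x hx
    rw [← I.coe_terminalFinset]
    exact hsub l j hx
  -- If instance `l` pays for cluster `A` on level `j`, some request of that scale has an endpoint
  -- in `A` and class at least `j`. Its endpoints are at distance at least `2 ^ j`, so the partner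
  -- is outside `A` and `2 ^ l ≤ I.req i ≤ w j A`.
  have hscale : ∀ l j A, A ∈ (highTerminals (I.arrived l I.n le_rfl) j).image (κ j) →
      2 ^ l ≤ w j A := by
    intro l j A hA
    obtain ⟨x, hx, rfl⟩ := Finset.mem_image.1 hA
    obtain ⟨r, hr, hj, h⟩ := mem_highTerminals.1 hx
    obtain ⟨i, _, rfl, rfl⟩ := I.mem_arrived.1 hr
    refine (Nat.pow_log_le_self 2 (by have := I.req_pos i; omega)).trans (hw j i _ ?_ ?_)
    · intro heq
      have h1 := hκ j _ (I.src_mem i) _ (I.tgt_mem i) heq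
      have h2 := pow_pairClass_le (d := dist) (r := (I.src i, I.tgt i))
        (hsep _ _ (I.src_ne_tgt i))
      have h3 : (2 : ℝ) ^ j ≤ 2 ^ pairClass dist (I.src i, I.tgt i) :=
        pow_le_pow_right₀ (by norm_num) hj
      simp only at h2
      linarith
    · rcases h with rfl | rfl
      · exact Or.inl rfl
      · exact Or.inr rfl
  rw [I.algCost_eq hL]
  calc ∑ l ∈ Finset.range L, (2 : ℝ) ^ (l + 1) *
        cost distLen (bermanCoulston dist (I.arrived l I.n le_rfl))
      ≤ ∑ l ∈ Finset.range L, (2 : ℝ) ^ (l + 1) * ∑ j ∈ Finset.range K, 2 ^ (j + 1) *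
          ∑ A ∈ I.terminalFinset.image (κ j),
            if A ∈ (highTerminals (I.arrived l I.n le_rfl) j).image (κ j) then (1 : ℝ) else 0 := by
        refine Finset.sum_le_sum fun l _ => mul_le_mul_of_nonneg_left ?_ (by positivity)
        refine (cost_bermanCoulston_le hsep κ K _ ?_ ?_).trans (le_of_eq ?_)
        · intro r hr
          obtain ⟨i, _, _, rfl⟩ := I.mem_arrived.1 hr
          exact hK i
        · exact fun j x hx y hy => hκ j x (hterm l 0 x hx) y (hterm l 0 y hy)
        · refine Finset.sum_congr rfl fun j _ => ?_
          rw [Finset.sum_ite_mem,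
            Finset.inter_eq_right.2 (Finset.image_subset_image (hsub l j))]
          simp
    -- Summing over scales innermost leaves, for each cluster, a sum of distinct powers of two, each
    -- at most twice the capacity.
    _ = ∑ j ∈ Finset.range K, 2 ^ (j + 1) * ∑ A ∈ I.terminalFinset.image (κ j),
          ∑ l ∈ Finset.range L,
            if A ∈ (highTerminals (I.arrived l I.n le_rfl) j).image (κ j) then
              (2 : ℝ) ^ (l + 1) else 0 := by
        simp only [Finset.mul_sum]
        rw [Finset.sum_comm]
        refine Finset.sum_congr rfl fun j _ => ?_
        rw [Finset.sum_comm]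
        refine Finset.sum_congr rfl fun A _ => Finset.sum_congr rfl fun l _ => ?_
        split_ifs <;> ring
    _ ≤ ∑ j ∈ Finset.range K, 2 ^ (j + 1) * ∑ A ∈ I.terminalFinset.image (κ j),
          (4 * w j A : ℝ) := by
        refine Finset.sum_le_sum fun j _ => mul_le_mul_of_nonneg_left ?_ (by positivity)
        refine Finset.sum_le_sum fun A _ => ?_
        rw [← Finset.sum_filter]
        exact_mod_cast sum_two_pow_le_of_forall_le _ (w j A)
          fun l hl => hscale l j A (Finset.mem_filter.1 hl).2
    _ = _ := by
        simp only [Finset.mul_sum]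
        refine Finset.sum_congr rfl fun j _ => Finset.sum_congr rfl fun A _ => ?_
        ring

/-! ### Random partitions -/

/-- In a random order `x` is the first element of `S` with probability at most `1 / S.card`:
composing with a transposition shows that all elements of `S` are equally likely to be first, and
these events are disjoint. -/
theorem card_argmin_mul_card_le {ι : Type*} [Fintype ι] [LinearOrder ι] {S : Finset ι} {x : ι}
    (hx : x ∈ S) :
    (Finset.univ.filter fun π : Equiv.Perm ι => ∀ y ∈ S, π x ≤ π y).card * S.card ≤
      Fintype.card (Equiv.Perm ι) := by
  have hcard : ∀ y ∈ S, (Finset.univ.filter fun π : Equiv.Perm ι => ∀ z ∈ S, π y ≤ π z).card =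
      (Finset.univ.filter fun π : Equiv.Perm ι => ∀ z ∈ S, π x ≤ π z).card := by
    intro y hy
    have hswap : ∀ z ∈ S, Equiv.swap x y z ∈ S := by
      intro z hz
      by_cases h1 : z = x
      · rw [h1, Equiv.swap_apply_left]; exact hy
      · by_cases h2 : z = y
        · rw [h2, Equiv.swap_apply_right]; exact hx
        · rw [Equiv.swap_apply_of_ne_of_ne h1 h2]; exact hz
    refine Finset.card_bij' (fun π _ => π * Equiv.swap x y) (fun π _ => π * Equiv.swap x y)
      ?_ ?_ ?_ ?_
    · intro π hπ
      simp only [Finset.mem_filter, Finset.mem_univ, true_and, Equiv.Perm.mul_apply,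
        Equiv.swap_apply_left] at hπ ⊢
      exact fun z hz => hπ _ (hswap z hz)
    · intro π hπ
      simp only [Finset.mem_filter, Finset.mem_univ, true_and, Equiv.Perm.mul_apply,
        Equiv.swap_apply_right] at hπ ⊢
      exact fun z hz => hπ _ (hswap z hz)
    · intro π _
      simp [mul_assoc]
    · intro π _
      simp [mul_assoc]
  have hdisj : (S : Set ι).PairwiseDisjoint
      fun y => Finset.univ.filter fun π : Equiv.Perm ι => ∀ z ∈ S, π y ≤ π z := by
    intro y hy z hz hyz
    refine Finset.disjoint_left.2 fun π h1 h2 => hyz ?_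
    simp only [Finset.mem_filter, Finset.mem_univ, true_and] at h1 h2
    exact π.injective (le_antisymm (h1 z hz) (h2 y hy))
  rw [mul_comm, ← smul_eq_mul, ← Finset.sum_const, ← Finset.sum_congr rfl hcard,
    ← Finset.card_biUnion hdisj]
  exact Finset.card_le_univ _

/-- Adding an element of largest value contributes the reciprocal of the new cardinality. Ties can
only raise the ranks of the others. -/
theorem sum_inv_rank_le_harmonic {ι : Type*} (s : Finset ι) (m : ι → ℝ) :
    ∑ x ∈ s, ((s.filter fun y => m y ≤ m x).card : ℝ)⁻¹ ≤ harmonic s.card := by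
  classical
  induction s using Finset.induction_on_max_value m with
  | empty => simp
  | insert a s ha hmax ih =>
    rw [Finset.sum_insert ha, Finset.card_insert_of_notMem ha, harmonic_succ]
    have h1 : ((insert a s).filter fun y => m y ≤ m a) = insert a s := by
      refine Finset.filter_true_of_mem fun y hy => ?_
      rcases Finset.mem_insert.1 hy with rfl | hy
      · exact le_rfl
      · exact hmax y hy
    rw [h1, Finset.card_insert_of_notMem ha]
    have h2 : ∑ x ∈ s, (((insert a s).filter fun y => m y ≤ m x).card : ℝ)⁻¹ ≤
        ∑ x ∈ s, ((s.filter fun y => m y ≤ m x).card : ℝ)⁻¹ := by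
      refine Finset.sum_le_sum fun x hx => ?_
      have hpos : 0 < (s.filter fun y => m y ≤ m x).card :=
        Finset.card_pos.2 ⟨x, Finset.mem_filter.2 ⟨hx, le_rfl⟩⟩
      have hle := Finset.card_le_card
        (Finset.filter_subset_filter (fun y => m y ≤ m x) (Finset.subset_insert a s))
      gcongr
    push_cast
    linarith

open scoped Classical in
/-- For every nonnegative weight, some order of the centres makes the total weight of the centres
that come first among those below them no more than the weight times a harmonic number. -/
theorem exists_perm_sum_le {ι E : Type*} [Fintype ι] [LinearOrder ι] [Fintype E]
    (m len : E → ι → ℝ) (D : E → ℝ) (hlen : ∀ e i, 0 ≤ len e i) (hD : ∀ e i, len e i ≤ D e) :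
    ∃ π : Equiv.Perm ι,
      ∑ e, ∑ i, (if ∀ i', m e i' ≤ m e i → π i ≤ π i' then len e i else 0) ≤
        harmonic (Fintype.card ι) * ∑ e, D e := by
  set T : ℝ := harmonic (Fintype.card ι) * ∑ e, D e
  have hsum : ∑ π : Equiv.Perm ι,
      ∑ e, ∑ i, (if ∀ i', m e i' ≤ m e i → π i ≤ π i' then len e i else 0) ≤
        ∑ _π : Equiv.Perm ι, T := by
    have hcard : (0 : ℝ) < Fintype.card (Equiv.Perm ι) := by exact_mod_cast Fintype.card_pos
    calc ∑ π : Equiv.Perm ι,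
          ∑ e, ∑ i, (if ∀ i', m e i' ≤ m e i → π i ≤ π i' then len e i else 0)
        = ∑ e, ∑ i, ((Finset.univ.filter fun π : Equiv.Perm ι =>
            ∀ i', m e i' ≤ m e i → π i ≤ π i').card : ℝ) * len e i := by
          rw [Finset.sum_comm]
          refine Finset.sum_congr rfl fun e _ => ?_
          rw [Finset.sum_comm]
          refine Finset.sum_congr rfl fun i _ => ?_
          rw [← Finset.sum_filter, Finset.sum_const, nsmul_eq_mul]
      _ ≤ ∑ e, ∑ i, Fintype.card (Equiv.Perm ι) *
            ((Finset.univ.filter fun i' => m e i' ≤ m e i).card : ℝ)⁻¹ * D e := by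
          refine Finset.sum_le_sum fun e _ => Finset.sum_le_sum fun i _ => ?_
          have hmem : i ∈ Finset.univ.filter fun i' => m e i' ≤ m e i := by simp
          have h := card_argmin_mul_card_le hmem
          simp only [Finset.mem_filter, Finset.mem_univ, true_and] at h
          have hpos : (0 : ℝ) < (Finset.univ.filter fun i' => m e i' ≤ m e i).card := by
            exact_mod_cast Finset.card_pos.2 ⟨i, hmem⟩
          refine mul_le_mul ?_ (hD e i) (hlen e i) (by positivity)
          rw [← div_eq_mul_inv, le_div_iff₀ hpos]
          exact_mod_cast h
      _ = ∑ e, Fintype.card (Equiv.Perm ι) *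
            (∑ i, ((Finset.univ.filter fun i' => m e i' ≤ m e i).card : ℝ)⁻¹) * D e := by
          simp only [Finset.mul_sum, Finset.sum_mul]
      _ ≤ ∑ e, Fintype.card (Equiv.Perm ι) * (harmonic (Fintype.card ι) : ℝ) * D e := by
          refine Finset.sum_le_sum fun e _ => ?_
          by_cases hne : Nonempty ι
          · obtain ⟨i⟩ := hne
            have hDe : 0 ≤ D e := (hlen e i).trans (hD e i)
            have := sum_inv_rank_le_harmonic Finset.univ (m e)
            rw [Finset.card_univ] at this
            gcongr
          · rw [not_nonempty_iff] at hne
            simp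
      _ = _ := by
          simp only [T]
          rw [Finset.sum_const, Finset.card_univ, nsmul_eq_mul, Finset.mul_sum, Finset.mul_sum]
          exact Finset.sum_congr rfl fun e _ => by ring
  -- The bound holds on average over all orders, hence for one of them.
  obtain ⟨π, _, hπ⟩ := Finset.exists_le_of_sum_le Finset.univ_nonempty hsum
  exact ⟨π, hπ⟩

/-- The bound is an increment of the clamp `fun t => max m (min M t)`, so that it telescopes over
adjacent intervals. -/
theorem volume_real_Ico_inter_Ico_le {α β m M : ℝ} (hαβ : α ≤ β) (hmM : m ≤ M) :
    MeasureTheory.volume.real (Set.Ico α β ∩ Set.Ico m M) ≤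
      max m (min M β) - max m (min M α) := by
  rw [Set.Ico_inter_Ico, Real.volume_real_Ico]
  rcases le_total m α with h1 | h1 <;> rcases le_total M β with h2 | h2 <;>
    rcases le_total M α with h3 | h3 <;> rcases le_total m β with h4 | h4 <;>
    simp only [max_def, min_def] <;> split_ifs <;> linarith

-- Some `r` does no worse than the average over a uniform radius in `[α, β)`.
open scoped Classical in
theorem exists_radius {J : Type*} [Fintype J] (w m M : J → ℝ) (hmM : ∀ i, m i ≤ M i)
    (hw : ∀ i, 0 ≤ w i) {α β : ℝ} (hαβ : α < β) :
    ∃ r ∈ Set.Ico α β, (β - α) * ∑ i, (if m i ≤ r ∧ r < M i then w i else 0) ≤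
      ∑ i, w i * (max (m i) (min (M i) β) - max (m i) (min (M i) α)) := by
  have hvol : MeasureTheory.volume (Set.Ico α β) ≠ 0 := by
    simp [Real.volume_Ico, hαβ]
  have hvol' : MeasureTheory.volume (Set.Ico α β) ≠ ⊤ := by simp [Real.volume_Ico]
  have hint : ∀ i, MeasureTheory.IntegrableOn
      ((Set.Ico (m i) (M i)).indicator fun _ => w i) (Set.Ico α β) := fun i =>
    (MeasureTheory.integrableOn_const hvol').indicator measurableSet_Ico
  obtain ⟨r, hr, hle⟩ := MeasureTheory.exists_le_setAverage hvol hvol'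
    (f := fun r => ∑ i, (Set.Ico (m i) (M i)).indicator (fun _ => w i) r)
    (MeasureTheory.integrable_finsetSum _ fun i _ => hint i)
  refine ⟨r, hr, ?_⟩
  rw [MeasureTheory.setAverage_eq, MeasureTheory.integral_finsetSum _ fun i _ => hint i,
    Real.volume_real_Ico_of_le hαβ.le, smul_eq_mul, inv_mul_eq_div,
    le_div_iff₀' (by linarith)] at hle
  refine (le_of_eq ?_).trans (hle.trans ?_)
  · exact congrArg _ (Finset.sum_congr rfl fun i _ => by simp [Set.indicator, Set.mem_Ico])
  · refine Finset.sum_le_sum fun i _ => ?_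
    rw [MeasureTheory.setIntegral_indicator measurableSet_Ico, MeasureTheory.setIntegral_const,
      smul_eq_mul, mul_comm]
    exact mul_le_mul_of_nonneg_left (volume_real_Ico_inter_Ico_le hαβ.le (hmM i)) (hw i)

open scoped Classical in
/-- The first centre, in the order `π`, at distance at most `r` from `v`. -/
def firstCenter {V ι : Type*} [MetricSpace V] [Fintype ι] [LinearOrder ι] (c : ι → V)
    (π : Equiv.Perm ι) (r : ℝ) (v : V) : Option ι :=
  if h : (Finset.univ.filter fun i => dist v (c i) ≤ r).Nonempty then
    some (Finset.exists_min_image _ π h).choose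
  else none

theorem firstCenter_eq_none {V ι : Type*} [MetricSpace V] [Fintype ι] [LinearOrder ι] {c : ι → V}
    {π : Equiv.Perm ι} {r : ℝ} {v : V} :
    firstCenter c π r v = none ↔ ∀ i, r < dist v (c i) := by
  unfold firstCenter
  split_ifs with h
  · obtain ⟨i, hi⟩ := h
    simp only [Finset.mem_filter, Finset.mem_univ, true_and] at hi
    simpa using ⟨i, hi⟩
  · rw [Finset.not_nonempty_iff_eq_empty, Finset.filter_eq_empty_iff] at h
    simpa using h

theorem firstCenter_eq_some {V ι : Type*} [MetricSpace V] [Fintype ι] [LinearOrder ι] {c : ι → V}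
    {π : Equiv.Perm ι} {r : ℝ} {v : V} {i : ι} :
    firstCenter c π r v = some i ↔
      dist v (c i) ≤ r ∧ ∀ i', dist v (c i') ≤ r → π i ≤ π i' := by
  unfold firstCenter
  split_ifs with h
  · have hs := (Finset.exists_min_image _ π h).choose_spec
    set i₀ := (Finset.exists_min_image _ π h).choose
    simp only [Finset.mem_filter, Finset.mem_univ, true_and] at hs
    rw [Option.some_inj]
    constructor
    · intro h
      rwa [h] at hs
    · exact fun h => π.injective (le_antisymm (hs.2 i h.1) (h.2 i₀ hs.1))
  · rw [Finset.not_nonempty_iff_eq_empty, Finset.filter_eq_empty_iff] at h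
    simp only [false_iff, not_and]
    exact fun h1 => absurd h1 (h (Finset.mem_univ i))

/-- If `u` and `v` are in different clusters, some centre separates them that comes first among
all centres as close to `u` or `v`. -/
theorem exists_cut_center {V ι : Type*} [MetricSpace V] [Fintype ι] [LinearOrder ι] {c : ι → V}
    {π : Equiv.Perm ι} {r : ℝ} {u v : V} (h : firstCenter c π r u ≠ firstCenter c π r v) :
    ∃ i, (min (dist u (c i)) (dist v (c i)) ≤ r ∧ r < max (dist u (c i)) (dist v (c i))) ∧
      ∀ i', min (dist u (c i')) (dist v (c i')) ≤ min (dist u (c i)) (dist v (c i)) →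
        π i ≤ π i' := by
  classical
  have hne : (Finset.univ.filter fun i => min (dist u (c i)) (dist v (c i)) ≤ r).Nonempty := by
    by_contra hempty
    rw [Finset.not_nonempty_iff_eq_empty, Finset.filter_eq_empty_iff] at hempty
    have hlt : ∀ i, r < dist u (c i) ∧ r < dist v (c i) := fun i => by
      simpa using hempty (Finset.mem_univ i)
    exact h ((firstCenter_eq_none.2 fun i => (hlt i).1).trans
      (firstCenter_eq_none.2 fun i => (hlt i).2).symm)
  -- Take the first centre within `r` of `u` or `v`. Were it within `r` of both, both would be
  -- assigned to it.
  obtain ⟨i, hi, hmin⟩ := Finset.exists_min_image _ π hne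
  simp only [Finset.mem_filter, Finset.mem_univ, true_and] at hi hmin
  refine ⟨i, ⟨hi, ?_⟩, fun i' hi' => hmin i' (hi'.trans hi)⟩
  by_contra hmax
  rw [not_lt, max_le_iff] at hmax
  exact h ((firstCenter_eq_some.2 ⟨hmax.1, fun i' hi' => hmin i' (min_le_of_left_le hi')⟩).trans
    (firstCenter_eq_some.2 ⟨hmax.2, fun i' hi' => hmin i' (min_le_of_right_le hi')⟩).symm)

open scoped Classical in
/-- Partitions into balls whose radii are geometric in the level, such that the edges cut on all
levels together cost no more than a harmonic number times the total length of the edges. -/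
theorem exists_partitions {V ι E : Type*} [MetricSpace V] [Fintype ι] [LinearOrder ι] [Fintype E]
    (c : ι → V) (a b : E → V) :
    ∃ (π : Equiv.Perm ι) (r : ℕ → ℝ), (∀ j, 0 ≤ r j ∧ r j < 2 ^ j / 2) ∧
      ∀ K, ∑ j ∈ Finset.range K, (2 : ℝ) ^ j *
          ∑ e, (if firstCenter c π (r j) (a e) ≠ firstCenter c π (r j) (b e) then (1 : ℝ) else 0) ≤
        4 * (harmonic (Fintype.card ι) * ∑ e, dist (a e) (b e)) := by
  set m : E → ι → ℝ := fun e i => min (dist (a e) (c i)) (dist (b e) (c i)) with hm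
  set M : E → ι → ℝ := fun e i => max (dist (a e) (c i)) (dist (b e) (c i)) with hM
  have hmM : ∀ e i, m e i ≤ M e i := fun e i => min_le_max
  obtain ⟨π, hπ⟩ := exists_perm_sum_le m (fun e i => M e i - m e i)
    (fun e => dist (a e) (b e)) (fun e i => sub_nonneg.2 (hmM e i)) (fun e i => by
      simp only [hm, hM, max_sub_min_eq_abs]
      rw [abs_sub_comm]
      exact abs_dist_sub_le _ _ _)
  -- This weight depends neither on the level nor on the radius, so one order serves all levels.
  set w : E × ι → ℝ := fun p => if ∀ i', m p.1 i' ≤ m p.1 p.2 → π p.2 ≤ π i' then 1 else 0 with hw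
  -- The radius intervals `[2 ^ j / 4, 2 ^ j / 2)` of consecutive levels abut, hence the telescoping
  -- below. Their length `2 ^ j / 4` is the source of the factor `4`, and their upper end keeps
  -- diameters below `2 ^ j`.
  have hw0 : ∀ p, 0 ≤ w p := fun p => by simp only [hw]; split_ifs <;> norm_num
  have hrad := fun j : ℕ => exists_radius w (fun p => m p.1 p.2) (fun p => M p.1 p.2)
    (fun p => hmM p.1 p.2) hw0 (α := 2 ^ j / 4) (β := 2 ^ j / 2)
    (by have : (0 : ℝ) < 2 ^ j := by positivity
        linarith)
  choose r hr hrle using hrad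
  refine ⟨π, r, fun j => ⟨le_trans (by positivity) (hr j).1, (hr j).2⟩, fun K => ?_⟩
  have hcut : ∀ j e,
      (if firstCenter c π (r j) (a e) ≠ firstCenter c π (r j) (b e) then (1 : ℝ) else 0) ≤
        ∑ i, (if m e i ≤ r j ∧ r j < M e i then w (e, i) else 0) := by
    intro j e
    have hnn : ∀ i ∈ Finset.univ,
        0 ≤ (if m e i ≤ r j ∧ r j < M e i then w (e, i) else 0) := fun i _ => by
      split_ifs
      · exact hw0 _
      · exact le_rfl
    split_ifs with h
    · obtain ⟨i, h1, h2⟩ := exists_cut_center h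
      refine le_trans (le_of_eq ?_) (Finset.single_le_sum hnn (Finset.mem_univ i))
      rw [if_pos h1]
      exact (if_pos h2).symm
    · exact Finset.sum_nonneg hnn
  calc ∑ j ∈ Finset.range K, (2 : ℝ) ^ j *
          ∑ e, (if firstCenter c π (r j) (a e) ≠ firstCenter c π (r j) (b e) then (1 : ℝ) else 0)
      ≤ ∑ j ∈ Finset.range K, 4 * ∑ p : E × ι, w p *
          (max (m p.1 p.2) (min (M p.1 p.2) (2 ^ (j + 1) / 4)) -
            max (m p.1 p.2) (min (M p.1 p.2) (2 ^ j / 4))) := by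
        refine Finset.sum_le_sum fun j _ => ?_
        have h1 := hrle j
        have h2 := mul_le_mul_of_nonneg_left
          (Finset.sum_le_sum fun e (_ : e ∈ Finset.univ) => hcut j e)
          (by positivity : (0 : ℝ) ≤ 2 ^ j)
        refine h2.trans ?_
        have h3 : (2 : ℝ) ^ (j + 1) / 4 = 2 ^ j / 2 := by ring
        rw [h3]
        rw [Fintype.sum_prod_type] at h1
        have h4 : (2 : ℝ) ^ j / 2 - 2 ^ j / 4 = 2 ^ j / 4 := by ring
        rw [h4] at h1
        linarith
    _ = 4 * ∑ p : E × ι, w p *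
          (max (m p.1 p.2) (min (M p.1 p.2) (2 ^ K / 4)) -
            max (m p.1 p.2) (min (M p.1 p.2) (2 ^ 0 / 4))) := by
        rw [← Finset.mul_sum, Finset.sum_comm]
        congr 1
        refine Finset.sum_congr rfl fun p _ => ?_
        rw [← Finset.mul_sum]
        congr 1
        exact Finset.sum_range_sub
          (fun j => max (m p.1 p.2) (min (M p.1 p.2) ((2 : ℝ) ^ j / 4))) K
    _ ≤ 4 * ∑ p : E × ι, w p * (M p.1 p.2 - m p.1 p.2) := by
        refine mul_le_mul_of_nonneg_left (Finset.sum_le_sum fun p _ =>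
          mul_le_mul_of_nonneg_left (sub_le_sub ?_ (le_max_left _ _)) (hw0 p)) (by norm_num)
        exact max_le (hmM _ _) (min_le_left _ _)
    _ ≤ _ := by
        refine mul_le_mul_of_nonneg_left (le_trans (le_of_eq ?_) hπ) (by norm_num)
        rw [Fintype.sum_prod_type]
        refine Finset.sum_congr rfl fun e _ => Finset.sum_congr rfl fun i _ => ?_
        simp only [hw, ite_mul, one_mul, zero_mul]

/-! ### Competitiveness against the optimum -/

theorem exists_edge_family {W : Type*} (H : Multiset (Sym2 W)) :
    ∃ (N : ℕ) (a b : Fin N → W), H = Finset.univ.val.map fun e => s(a e, b e) := by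
  induction H using Multiset.induction_on with
  | empty => exact ⟨0, Fin.elim0, Fin.elim0, by simp⟩
  | cons e H ih =>
    obtain ⟨N, a, b, rfl⟩ := ih
    induction e using Sym2.ind with
    | _ x y =>
      refine ⟨N + 1, Fin.cons x a, Fin.cons y b, ?_⟩
      rw [Fin.univ_succ]
      simp
      exact List.Perm.refl _

-- The capacity of a cluster is the number of edges of `H` leaving it, and each cut edge leaves two
-- clusters. The constant is `64 = 8 * 2 * 4`, from `algCost_le_clusters`, this double count and
-- `exists_partitions`. Clusters are defined on all of `V`, as `H` may use vertices that are not
-- terminals.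
open scoped Classical in
theorem Instance.algCost_le_of_feasible {V : Type*} [MetricSpace V]
    (hsep : ∀ u v : V, u ≠ v → 1 ≤ dist u v) (I : Instance V) {H : Multiset (Sym2 V)}
    (hH : ∀ i, HasDisjointPaths H (I.src i) (I.tgt i) (I.req i)) :
    I.algCost networkAlgorithm ≤ 64 * (harmonic I.k * cost distLen H) := by
  obtain ⟨K, hK⟩ := I.exists_pairClass_lt
  obtain ⟨N, a, b, hab⟩ := exists_edge_family H
  set c : Fin I.k → V := fun i =>
    (I.terminalFinset.equivFinOfCardEq I.card_terminalFinset).symm i with hc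
  have hsurj : ∀ x ∈ I.terminals, ∃ i, c i = x := by
    intro x hx
    rw [← I.coe_terminalFinset] at hx
    exact ⟨I.terminalFinset.equivFinOfCardEq I.card_terminalFinset ⟨x, hx⟩, by simp [hc]⟩
  obtain ⟨π, r, hr, hcut⟩ := exists_partitions c a b
  have hcost : cost distLen H = ∑ e, dist (a e) (b e) := by
    rw [hab, cost, Multiset.map_map]
    rfl
  refine (I.algCost_le_clusters hsep (fun j => firstCenter c π (r j))
    (fun j A => H.countP (Crosses {v | firstCenter c π (r j) v = A})) hK ?_ ?_).trans ?_
  · intro j x hx y hy hxy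
    obtain ⟨i₀, hi₀⟩ := hsurj x hx
    -- A terminal is a centre at distance `0` from itself, so the cluster `none` contains no
    -- terminal.
    cases h : firstCenter c π (r j) x with
    | none =>
      have := firstCenter_eq_none.1 h i₀
      rw [hi₀, dist_self] at this
      exact absurd (hr j).1 (not_le.2 this)
    | some i =>
      have h1 := (firstCenter_eq_some.1 h).1
      have h2 := (firstCenter_eq_some.1 (hxy.symm.trans h)).1
      have h3 := dist_triangle_right x y (c i)
      have h4 := (hr j).2
      linarith
  · intro j i A hne hA
    refine (hH i).le_countP_crosses_of_ne ?_
    simp only [Set.mem_ofPred_eq]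
    rcases hA with rfl | rfl
    · simpa using Ne.symm hne
    · simpa using hne
  · have hcount : ∀ j (X : Finset (Option (Fin I.k))),
        ∑ A ∈ X, (H.countP (Crosses {v | firstCenter c π (r j) v = A}) : ℝ) ≤
          2 * ∑ e, (if firstCenter c π (r j) (a e) ≠ firstCenter c π (r j) (b e)
            then (1 : ℝ) else 0) := by
      intro j X
      have h1 : ∀ A, (H.countP (Crosses {v | firstCenter c π (r j) v = A}) : ℝ) =
          ∑ e, if Crosses {v | firstCenter c π (r j) v = A} s(a e, b e) then (1 : ℝ) else 0 := by
        intro A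
        rw [hab, Multiset.countP_map, Finset.sum_boole]
        rfl
      simp only [h1]
      rw [Finset.sum_comm, Finset.mul_sum]
      refine Finset.sum_le_sum fun e _ => ?_
      rw [Finset.sum_boole]
      have hsub : (X.filter fun A => Crosses {v | firstCenter c π (r j) v = A} s(a e, b e)) ⊆
          if firstCenter c π (r j) (a e) ≠ firstCenter c π (r j) (b e) then
            {firstCenter c π (r j) (a e), firstCenter c π (r j) (b e)} else ∅ := by
        intro A hA
        have hcr := (Finset.mem_filter.1 hA).2
        simp only [Crosses, Sym2.mem_iff, Set.mem_ofPred_eq, exists_eq_or_imp, exists_eq_left]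
          at hcr
        split_ifs with h
        · simp only [Finset.mem_insert, Finset.mem_singleton]
          tauto
        · rw [not_not] at h
          rw [h] at hcr
          tauto
      have hle := Finset.card_le_card hsub
      split_ifs at hle ⊢ with h
      · have := hle.trans Finset.card_le_two
        rw [mul_one]
        exact_mod_cast this
      · simpa using hle
    refine (mul_le_mul_of_nonneg_left (Finset.sum_le_sum fun j _ =>
      mul_le_mul_of_nonneg_left (hcount j _) (by positivity)) (by norm_num)).trans ?_
    have h3 : ∑ j ∈ Finset.range K, (2 : ℝ) ^ j * (2 * ∑ e,
          (if firstCenter c π (r j) (a e) ≠ firstCenter c π (r j) (b e)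
            then (1 : ℝ) else 0)) = 2 * ∑ j ∈ Finset.range K, (2 : ℝ) ^ j * ∑ e,
          (if firstCenter c π (r j) (a e) ≠ firstCenter c π (r j) (b e)
            then (1 : ℝ) else 0) := by
      rw [Finset.mul_sum]
      exact Finset.sum_congr rfl fun j _ => by ring
    have h4 := hcut K
    rw [Fintype.card_fin, ← hcost] at h4
    linarith

theorem Instance.one_lt_k {V : Type*} (I : Instance V) (hn : 0 < I.n) : 1 < I.k := by
  rw [← I.card_terminalFinset, Finset.one_lt_card]
  refine ⟨I.src ⟨0, hn⟩, ?_, I.tgt ⟨0, hn⟩, ?_, I.src_ne_tgt _⟩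
  · rw [← Finset.mem_coe, I.coe_terminalFinset]; exact I.src_mem _
  · rw [← Finset.mem_coe, I.coe_terminalFinset]; exact I.tgt_mem _

theorem cost_distLen_nonneg {V : Type*} [MetricSpace V] (H : Multiset (Sym2 V)) :
    0 ≤ cost distLen H := by
  refine Multiset.sum_nonneg fun x hx => ?_
  obtain ⟨e, _, rfl⟩ := Multiset.mem_map.1 hx
  induction e using Sym2.ind with
  | _ u v => exact dist_nonneg

/-- This keeps `I.opt` from being the infimum of the empty set, which would be `0`. The algorithm's
own final solution is feasible. -/
theorem Instance.exists_feasible {V : Type*} [MetricSpace V]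
    (hsep : ∀ u v : V, u ≠ v → 1 ≤ dist u v) (I : Instance V) :
    ∃ H : Multiset (Sym2 V), ∀ i, HasDisjointPaths H (I.src i) (I.tgt i) (I.req i) := by
  rcases Nat.eq_zero_or_pos I.n with hn | hn
  · exact ⟨0, fun i => absurd i.isLt (by omega)⟩
  · exact ⟨_, fun i => I.maintains_networkAlgorithm hsep ⟨I.n - 1, by omega⟩ i
      (Fin.le_def.2 (by have := i.isLt; simp only; omega))⟩

theorem Instance.algCost_of_n_eq_zero {V : Type*} [MetricSpace V] (I : Instance V) (hn : I.n = 0) :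
    I.algCost networkAlgorithm = 0 := by
  have : IsEmpty (Fin I.n) := by rw [hn]; infer_instance
  simp [Instance.algCost, cost_zero]

theorem Instance.algCost_le_opt {V : Type*} [MetricSpace V]
    (hsep : ∀ u v : V, u ≠ v → 1 ≤ dist u v) (I : Instance V) :
    I.algCost networkAlgorithm ≤ 192 * Real.log I.k * I.opt := by
  rcases Nat.eq_zero_or_pos I.n with hn | hn
  · have hk : I.k = 0 := by
      have : IsEmpty (Fin I.n) := by rw [hn]; infer_instance
      rw [Instance.k, Instance.terminals, Set.range_eq_empty, Set.range_eq_empty, Set.union_empty,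
        Set.ncard_empty]
    rw [I.algCost_of_n_eq_zero hn, hk]
    simp
  have hk := I.one_lt_k hn
  have hlog2 : Real.log 2 ≤ Real.log I.k :=
    Real.log_le_log (by norm_num) (by exact_mod_cast hk)
  have hlog2' := Real.log_two_gt_d9
  have hlog : 0 < Real.log I.k := by linarith
  -- Here `k ≥ 2`, so `1 ≤ 2 * Real.log 2 ≤ 2 * Real.log k` absorbs the additive constant; `64 * 3 =
  -- 192`.
  have hharm : (harmonic I.k : ℝ) ≤ 3 * Real.log I.k := by
    have := harmonic_le_one_add_log I.k
    linarith
  rw [← div_le_iff₀' (by positivity)]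
  obtain ⟨H₀, hH₀⟩ := I.exists_feasible hsep
  refine le_csInf ⟨_, H₀, hH₀, rfl⟩ ?_
  rintro _ ⟨H, hH, rfl⟩
  rw [div_le_iff₀' (by positivity)]
  have h1 := I.algCost_le_of_feasible hsep hH
  have h2 := mul_le_mul_of_nonneg_right hharm (cost_distLen_nonneg H)
  linarith

/-! ### Rooted trees -/

theorem exists_isChild {N : Type*} {G : SimpleGraph N} (hG : G.IsTree) {root z : N}
    (hz : z ≠ root) : ∃ p, IsChild G root p z := by
  obtain ⟨q, hq⟩ := hG.connected.exists_walk_length_eq_dist z root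
  cases q with
  | nil => exact absurd rfl hz
  | @cons _ y _ h q =>
    rw [SimpleGraph.Walk.length_cons] at hq
    have h1 := SimpleGraph.dist_le q
    rw [G.dist_comm] at h1 hq
    refine ⟨y, h.symm, ?_⟩
    rcases hG.dist_eq_dist_add_one_of_adj root h with h2 | h2
    · exact h2
    · omega

/-- Two parents would give two different paths from the root to `z`. -/
theorem IsChild.unique {N : Type*} {G : SimpleGraph N} (hG : G.IsTree) {root p p' z : N}
    (h : IsChild G root p z) (h' : IsChild G root p' z) : p = p' := by
  have hpath : ∀ {p}, IsChild G root p z → ∃ q : G.Walk root z, q.IsPath ∧ q.penultimate = p := by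
    intro p h
    obtain ⟨q, hq⟩ := hG.connected.exists_walk_length_eq_dist root p
    refine ⟨q.concat h.1, ?_, by simp⟩
    refine (q.concat h.1).isPath_of_length_eq_dist ?_
    rw [SimpleGraph.Walk.length_concat, hq, h.2]
  obtain ⟨q, hq, rfl⟩ := hpath h
  obtain ⟨q', hq', rfl⟩ := hpath h'
  rw [(hG.existsUnique_path root z).unique hq hq']

open scoped Classical in
/-- The parent of a node; the root is its own parent. -/
def parent {N : Type*} (G : SimpleGraph N) (root z : N) : N :=
  if h : ∃ p, IsChild G root p z then h.choose else z

theorem isChild_parent {N : Type*} {G : SimpleGraph N} (hG : G.IsTree) {root z : N}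
    (hz : z ≠ root) : IsChild G root (parent G root z) z := by
  rw [parent, dif_pos (exists_isChild hG hz)]
  exact (exists_isChild hG hz).choose_spec

theorem IsChild.parent_eq {N : Type*} {G : SimpleGraph N} (hG : G.IsTree) {root p z : N}
    (h : IsChild G root p z) : parent G root z = p := by
  refine (isChild_parent hG ?_).unique hG h
  rintro rfl
  have := h.2
  simp at this

theorem ne_root_of_dist_pos {N : Type*} {G : SimpleGraph N} {root z : N}
    (h : 0 < G.dist root z) : z ≠ root := by
  rintro rfl
  simp at h

theorem dist_iterate_parent {N : Type*} {G : SimpleGraph N} (hG : G.IsTree) {root z : N} {k : ℕ}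
    (hk : k ≤ G.dist root z) :
    G.dist root ((parent G root)^[k] z) + k = G.dist root z ∧
      G.dist ((parent G root)^[k] z) z ≤ k := by
  induction k with
  | zero => simp
  | succ k ih =>
    obtain ⟨h1, h2⟩ := ih (by omega)
    rw [Function.iterate_succ_apply']
    have hc := isChild_parent hG (root := root) (z := (parent G root)^[k] z)
      (ne_root_of_dist_pos (G := G) (by omega))
    have h3 := hc.2
    have h4 := SimpleGraph.dist_eq_one_iff_adj.2 hc.1
    have h5 := hG.connected.dist_triangle
      (u := parent G root ((parent G root)^[k] z)) (v := (parent G root)^[k] z) (w := z)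
    omega

theorem isBelow_iterate_parent {N : Type*} {G : SimpleGraph N} (hG : G.IsTree) {root z : N} {k : ℕ}
    (hk : k ≤ G.dist root z) : IsBelow G root ((parent G root)^[k] z) z := by
  obtain ⟨h1, h2⟩ := dist_iterate_parent hG hk
  have h3 := hG.connected.dist_triangle (u := root) (v := (parent G root)^[k] z) (w := z)
  unfold IsBelow
  omega

/-- The ancestor of `z` at depth `h`, or `z` itself if it is not that deep. -/
def ancestor {N : Type*} (G : SimpleGraph N) (root : N) (h : ℕ) (z : N) : N :=
  (parent G root)^[G.dist root z - h] z

theorem dist_ancestor {N : Type*} {G : SimpleGraph N} (hG : G.IsTree) (root : N) (h : ℕ) (z : N) :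
    G.dist root (ancestor G root h z) = min h (G.dist root z) := by
  have := (dist_iterate_parent hG (root := root) (z := z) (k := G.dist root z - h) (by omega)).1
  unfold ancestor
  omega

theorem ancestor_eq_self {N : Type*} {G : SimpleGraph N} {root : N} {h : ℕ} {z : N}
    (hz : G.dist root z ≤ h) : ancestor G root h z = z := by
  rw [ancestor, Nat.sub_eq_zero_of_le hz, Function.iterate_zero, id]

theorem isBelow_ancestor {N : Type*} {G : SimpleGraph N} (hG : G.IsTree) (root : N) (h : ℕ) (z : N) :
    IsBelow G root (ancestor G root h z) z :=
  isBelow_iterate_parent hG (by omega)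

/-- The nodes of the subtree below `w`. -/
def subtree {N : Type*} (G : SimpleGraph N) (root w : N) : Set N :=
  {z | G.dist root w ≤ G.dist root z ∧ ancestor G root (G.dist root w) z = w}

theorem ancestor_of_isChild {N : Type*} {G : SimpleGraph N} (hG : G.IsTree) {root a b : N}
    (h : IsChild G root a b) {k : ℕ} (hk : k ≤ G.dist root a) :
    ancestor G root k b = ancestor G root k a := by
  unfold ancestor
  rw [h.2, Nat.sub_add_comm hk, Function.iterate_succ_apply, h.parent_eq hG]

/-- The only edge that leaves the subtree below `w` is the one to the parent of `w`. -/
theorem eq_of_crosses_subtree {N : Type*} {G : SimpleGraph N} (hG : G.IsTree) {root w : N}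
    {e : Sym2 N} (he : e ∈ G.edgeSet) (hc : Crosses (subtree G root w) e) :
    e = s(parent G root w, w) := by
  have key : ∀ a b, IsChild G root a b → Crosses (subtree G root w) s(a, b) →
      s(a, b) = s(parent G root w, w) := by
    intro a b hab hcr
    have hdown : a ∈ subtree G root w → b ∈ subtree G root w := by
      rintro ⟨h1, h2⟩
      exact ⟨by rw [hab.2]; omega, (ancestor_of_isChild hG hab h1).trans h2⟩
    simp only [Crosses, Sym2.mem_iff, exists_eq_or_imp, exists_eq_left] at hcr
    obtain ⟨h1, h2⟩ : b ∈ subtree G root w := by tauto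
    have ha : a ∉ subtree G root w := by tauto
    by_cases hd : G.dist root w ≤ G.dist root a
    · exact absurd ⟨hd, (ancestor_of_isChild hG hab hd).symm.trans h2⟩ ha
    -- If `a` is shallower than `w`, its child `b` is no deeper than `w`; being in the subtree, `b`
    -- equals `w`.
    · have hbw : G.dist root b ≤ G.dist root w := by rw [hab.2]; omega
      rw [ancestor_eq_self hbw] at h2
      subst h2
      rw [hab.parent_eq hG]
  induction e using Sym2.ind with
  | _ a b =>
    rw [SimpleGraph.mem_edgeSet] at he
    rcases hG.dist_eq_dist_add_one_of_adj root he with h | h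
    · rw [Sym2.eq_swap] at hc ⊢
      exact key b a ⟨he.symm, h⟩ hc
    · exact key a b ⟨he, h⟩ hc

/-! ### Competitiveness against tree embeddings -/

theorem HST.len_pos {V : Type*} [MetricSpace V] {X : Set V} (T : HST X) {e : Sym2 T.Node}
    (he : e ∈ T.graph.edgeSet) : 0 < T.len e := by
  obtain ⟨j, hj⟩ := T.len_pow e he
  rw [hj]
  positivity

/-- The length of an edge is determined by the depth of its lower end. -/
theorem HST.exists_len_eq {V : Type*} [MetricSpace V] {X : Set V} (T : HST X) {w₀ : T.Node}
    (hw₀ : IsChild T.graph T.root T.root w₀) :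
    ∃ j₀ : ℤ, ∀ v w, IsChild T.graph T.root v w →
      T.len s(v, w) = 2 ^ (j₀ - T.graph.dist T.root w) := by
  obtain ⟨j₀, hj₀⟩ := T.len_pow s(T.root, w₀) hw₀.1
  refine ⟨j₀, ?_⟩
  have key : ∀ h : ℕ, ∀ v w, IsChild T.graph T.root v w → T.graph.dist T.root w = h + 1 →
      T.len s(v, w) = 2 ^ (j₀ - (h + 1 : ℕ)) := by
    intro h
    induction h with
    | zero =>
      intro v w hvw hw
      have hv : v = T.root := by
        have := hvw.2
        exact ((T.isTree.connected.dist_eq_zero_iff).1 (by omega)).symm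
      subst hv
      rw [T.len_children _ _ _ hvw hw₀, hj₀]
      simp
    | succ h ih =>
      intro v w hvw hw
      have hv : T.graph.dist T.root v = h + 1 := by
        have := hvw.2
        omega
      have hp := isChild_parent T.isTree (ne_root_of_dist_pos (by omega :
        0 < T.graph.dist T.root v))
      have h1 := T.len_halving _ _ _ hp hvw
      rw [ih _ _ hp hv] at h1
      have h2 : (2 : ℝ) ^ (j₀ - (h + 1 : ℕ)) = 2 * 2 ^ (j₀ - (h + 1 + 1 : ℕ)) := by
        rw [← zpow_one_add₀ (by norm_num)]
        congr 1
        push_cast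
        ring
      linarith
  intro v w hvw
  have := key (T.graph.dist T.root v) v w hvw hvw.2
  rw [hvw.2]
  exact this

theorem HST.cost_nonneg {V : Type*} [MetricSpace V] {X : Set V} (T : HST X)
    {H : Multiset (Sym2 T.Node)} (hH : ∀ e ∈ H, e ∈ T.graph.edgeSet) : 0 ≤ cost T.len H := by
  refine Multiset.sum_nonneg fun x hx => ?_
  obtain ⟨e, he, rfl⟩ := Multiset.mem_map.1 hx
  exact (T.len_pos (hH e he)).le

-- Distinct nodes have distinct edges to their parents, since two nodes cannot be each other's
-- parent; the sum counts each edge of `H` at most once.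
open scoped Classical in
theorem HST.sum_count_mul_len_le {V : Type*} [MetricSpace V] {X : Set V} (T : HST X)
    {H : Multiset (Sym2 T.Node)} (hH : ∀ e ∈ H, e ∈ T.graph.edgeSet) (s : Finset T.Node)
    (hs : T.root ∉ s) :
    ∑ w ∈ s, (H.count s(parent T.graph T.root w, w) : ℝ) *
      T.len s(parent T.graph T.root w, w) ≤ cost T.len H := by
  have hinj : Set.InjOn (fun w => s(parent T.graph T.root w, w)) (s : Set T.Node) := by
    intro w hw w' hw' h
    rcases Sym2.eq_iff.1 h with ⟨_, h⟩ | ⟨h1, h2⟩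
    · exact h
    · have h3 := (isChild_parent T.isTree (ne_of_mem_of_not_mem hw hs)).2
      have h4 := (isChild_parent T.isTree (ne_of_mem_of_not_mem hw' hs)).2
      rw [h1] at h3
      rw [← h2] at h4
      omega
  have hnn : ∀ e, 0 ≤ (H.count e : ℝ) * T.len e := by
    intro e
    by_cases he : e ∈ H
    · exact mul_nonneg (Nat.cast_nonneg _) (T.len_pos (hH e he)).le
    · rw [Multiset.count_eq_zero_of_notMem he]
      simp
  have hcost : cost T.len H = ∑ e ∈ H.toFinset, (H.count e : ℝ) * T.len e := by
    rw [cost, Finset.sum_multiset_map_count]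
    simp
  rw [hcost, ← Finset.sum_image (f := fun e => (H.count e : ℝ) * T.len e) hinj,
    ← Finset.sum_filter_add_sum_filter_not _ (fun e => e ∈ H)]
  have hzero : ∑ e ∈ (s.image fun w => s(parent T.graph T.root w, w)) with e ∉ H,
      (H.count e : ℝ) * T.len e = 0 := by
    refine Finset.sum_eq_zero fun e he => ?_
    rw [Multiset.count_eq_zero_of_notMem (Finset.mem_filter.1 he).2]
    simp
  rw [hzero, add_zero]
  refine Finset.sum_le_sum_of_subset_of_nonneg (fun e he => ?_) fun e _ _ => hnn e
  exact Multiset.mem_toFinset.2 (Finset.mem_filter.1 he).2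

-- The level-`j` cluster of a terminal is its ancestor at a depth where twice the edge above has
-- length at most `2 ^ j`. The capacity of a cluster is the multiplicity of that edge; the constant
-- is `128 = 8 * 16`.
open scoped Classical in
theorem Instance.algCost_le_of_tree_feasible {V : Type*} [MetricSpace V]
    (hsep : ∀ u v : V, u ≠ v → 1 ≤ dist u v) (I : Instance V) (hn : 0 < I.n)
    (T : HST I.terminals) {H : Multiset (Sym2 T.Node)} (hHT : ∀ e ∈ H, e ∈ T.graph.edgeSet)
    (hH : ∀ i, HasDisjointPaths H (T.leaf (I.src i)) (T.leaf (I.tgt i)) (I.req i)) :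
    I.algCost networkAlgorithm ≤ 128 * cost T.len H := by
  have hG := T.isTree
  set G := T.graph with hGdef
  set ρ := T.root with hρ
  set i₀ : Fin I.n := ⟨0, hn⟩
  have hleaf : ∀ x ∈ I.terminals, ∀ w, ¬ IsChild G ρ (T.leaf x) w := T.leaf_bijOn.mapsTo
  have hroot : ∃ w₀, IsChild G ρ ρ w₀ := by
    by_contra hno
    push Not at hno
    have hall : ∀ z, z = ρ := by
      intro z
      by_contra hz
      have hpos := hG.connected.pos_dist_of_ne (Ne.symm hz)
      have hd := dist_ancestor hG ρ 1 z
      have hc := isChild_parent hG (root := ρ) (z := ancestor G ρ 1 z)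
        (ne_root_of_dist_pos (G := G) (by omega))
      have h2 := hc.2
      have h3 : ρ = parent G ρ (ancestor G ρ 1 z) :=
        hG.connected.dist_eq_zero_iff.1 (by omega)
      rw [← h3] at hc
      exact hno _ hc
    exact I.src_ne_tgt i₀ (T.leaf_bijOn.injOn (I.src_mem i₀) (I.tgt_mem i₀)
      ((hall _).trans (hall _).symm))
  obtain ⟨w₀, hw₀⟩ := hroot
  obtain ⟨j₀, hlen⟩ := T.exists_len_eq hw₀
  have hleafpos : ∀ x ∈ I.terminals, 0 < G.dist ρ (T.leaf x) := by
    intro x hx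
    refine hG.connected.pos_dist_of_ne fun h => hleaf x hx w₀ ?_
    rwa [← h]
  have htop : T.len s(ρ, w₀) = 2 ^ (j₀ - 1) := by
    rw [hlen _ _ hw₀, hw₀.2]
    simp
  have hdist : ∀ x ∈ I.terminals, ∀ y ∈ I.terminals, dist x y ≤ (2 : ℝ) ^ (j₀ + 1) := by
    intro x hx y hy
    have := T.tall w₀ hw₀ x hx y hy
    have h2 : (2 : ℝ) ^ (j₀ + 1) = 4 * 2 ^ (j₀ - 1) := by
      rw [show j₀ + 1 = 2 + (j₀ - 1) by ring, zpow_add₀ (by norm_num)]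
      norm_num
    rw [h2, ← htop]
    exact this
  have hK : ∀ i, pairClass dist (I.src i, I.tgt i) < (j₀ + 2).toNat := by
    intro i
    have h1 := pow_pairClass_le (d := dist) (r := (I.src i, I.tgt i))
      (hsep _ _ (I.src_ne_tgt i))
    have h2 := h1.trans (hdist _ (I.src_mem i) _ (I.tgt_mem i))
    rw [← zpow_natCast, zpow_le_zpow_iff_right₀ (by norm_num)] at h2
    omega
  -- The edge above depth `d` has length `2 ^ (j₀ - d)`, so depth `j₀ + 1 - j` gives diameter less
  -- than `2 ^ j`. The maximum with `1` keeps the cluster away from the root, which has no edge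
  -- above it; it matters on the top level `j₀ + 1`.
  set h : ℕ → ℕ := fun j => max 1 (j₀ + 1 - j).toNat with hh
  set κ : ℕ → V → T.Node := fun j x => ancestor G ρ (h j) (T.leaf x) with hκ
  have hκdist : ∀ j x, G.dist ρ (κ j x) = min (h j) (G.dist ρ (T.leaf x)) := fun j x =>
    dist_ancestor hG ρ (h j) (T.leaf x)
  have hκroot : ∀ j, ∀ x ∈ I.terminals, κ j x ≠ ρ := by
    intro j x hx
    refine ne_root_of_dist_pos (G := G) ?_
    have h1 := hleafpos x hx
    have h2 : 1 ≤ h j := le_max_left _ _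
    rw [hκdist]
    omega
  have hmain := I.algCost_le_clusters hsep κ
    (fun _ w => H.count s(parent G ρ w, w)) hK ?_ ?_
  · refine hmain.trans ?_
    -- A node may serve as a cluster on many levels, for instance a leaf on all low ones, but only
    -- on levels `j ≤ j₀ + 2 - depth`; the last of these occurs only at depth one. The powers of two
    -- then add up to a multiple of the length of the edge above.
    have hsum : ∀ w ∈ I.terminalFinset.biUnion (fun x => (Finset.range (j₀ + 2).toNat).image
        fun j => κ j x), ∑ j ∈ Finset.range (j₀ + 2).toNat with
          w ∈ I.terminalFinset.image (κ j), (2 : ℝ) ^ j ≤ 16 * T.len s(parent G ρ w, w) := by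
      intro w hw
      obtain ⟨x, hx, hw⟩ := Finset.mem_biUnion.1 hw
      obtain ⟨j', _, rfl⟩ := Finset.mem_image.1 hw
      rw [← Finset.mem_coe, I.coe_terminalFinset] at hx
      set w := κ j' x with hwdef
      have hdw : ∀ j ∈ (Finset.range (j₀ + 2).toNat).filter
          (fun j => w ∈ I.terminalFinset.image (κ j)),
          (j : ℤ) ≤ j₀ + 2 - G.dist ρ w := by
        intro j hj
        obtain ⟨hj1, hj2⟩ := Finset.mem_filter.1 hj
        obtain ⟨y, _, hy⟩ := Finset.mem_image.1 hj2
        have h1 := hκdist j y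
        rw [hy] at h1
        have h2 := Finset.mem_range.1 hj1
        have h3 : h j = max 1 (j₀ + 1 - j).toNat := rfl
        omega
      rw [hlen _ _ (isChild_parent hG (hκroot j' x hx))]
      rcases ((Finset.range (j₀ + 2).toNat).filter
          (fun j => w ∈ I.terminalFinset.image (κ j))).eq_empty_or_nonempty with he | ⟨j₁, hj₁⟩
      · rw [he, Finset.sum_empty]
        positivity
      · have hB := hdw j₁ hj₁
        obtain ⟨B, hB'⟩ := Int.eq_ofNat_of_zero_le (show 0 ≤ j₀ + 2 - G.dist ρ w by omega)
        have h1 := sum_two_pow_le_of_forall_le _ (2 ^ B)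
          (fun j hj => Nat.pow_le_pow_right (by norm_num)
            (by have := hdw j hj; omega : j ≤ B))
        have h2 : ∑ j ∈ Finset.range (j₀ + 2).toNat with
          w ∈ I.terminalFinset.image (κ j), (2 : ℝ) ^ (j + 1) ≤ 4 * 2 ^ B := by
          exact_mod_cast h1
        simp only [pow_succ] at h2
        rw [← Finset.sum_mul] at h2
        have h3 : (2 : ℝ) ^ B = 4 * 2 ^ (j₀ - G.dist ρ w) := by
          rw [← zpow_natCast, show (B : ℤ) = 2 + (j₀ - G.dist ρ w) by omega,
            zpow_add₀ (by norm_num)]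
          norm_num
        have h4 : (0 : ℝ) < 2 ^ (j₀ - G.dist ρ w : ℤ) := by positivity
        linarith
    set U := I.terminalFinset.biUnion (fun x => (Finset.range (j₀ + 2).toNat).image
        fun j => κ j x) with hU
    have hUroot : ρ ∉ U := by
      intro hmem
      obtain ⟨x, hx, hw⟩ := Finset.mem_biUnion.1 hmem
      obtain ⟨j', _, hj'⟩ := Finset.mem_image.1 hw
      rw [← Finset.mem_coe, I.coe_terminalFinset] at hx
      exact hκroot j' x hx hj'
    have hbound := T.sum_count_mul_len_le hHT U hUroot
    have hswap : ∑ j ∈ Finset.range (j₀ + 2).toNat, (2 : ℝ) ^ j *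
        ∑ A ∈ I.terminalFinset.image (κ j), (H.count s(parent G ρ A, A) : ℝ) =
        ∑ w ∈ U, (H.count s(parent G ρ w, w) : ℝ) * ∑ j ∈ Finset.range (j₀ + 2).toNat with
          w ∈ I.terminalFinset.image (κ j), (2 : ℝ) ^ j := by
      simp only [Finset.mul_sum, Finset.sum_filter]
      rw [Finset.sum_comm]
      refine Finset.sum_congr rfl fun j hj => ?_
      have hsub : I.terminalFinset.image (κ j) ⊆ U := by
        intro w hw
        obtain ⟨x, hx, rfl⟩ := Finset.mem_image.1 hw
        exact Finset.mem_biUnion.2 ⟨x, hx, Finset.mem_image_of_mem (fun j => κ j x) hj⟩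
      simp only [mul_ite, mul_zero]
      rw [Finset.sum_ite_mem, Finset.inter_eq_right.2 hsub]
      exact Finset.sum_congr rfl fun w _ => mul_comm _ _
    have hfin : ∑ w ∈ U, (H.count s(parent G ρ w, w) : ℝ) *
        ∑ j ∈ Finset.range (j₀ + 2).toNat with
          w ∈ I.terminalFinset.image (κ j), (2 : ℝ) ^ j ≤
        16 * ∑ w ∈ U, (H.count s(parent G ρ w, w) : ℝ) * T.len s(parent G ρ w, w) := by
      rw [Finset.mul_sum]
      refine Finset.sum_le_sum fun w hw => ?_
      have := mul_le_mul_of_nonneg_left (hsum w hw)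
        (Nat.cast_nonneg (H.count s(parent G ρ w, w)) : (0 : ℝ) ≤ _)
      linarith
    rw [hswap]
    linarith
  · intro j x hx y hy hxy
    have hbx : IsBelow G ρ (κ j x) (T.leaf x) := isBelow_ancestor hG ρ _ _
    have hby : IsBelow G ρ (κ j x) (T.leaf y) := hxy ▸ isBelow_ancestor hG ρ _ _
    have hc := isChild_parent hG (hκroot j x hx)
    have hlt := T.diam_lt _ _ hc x hx y hy hbx hby
    have hdx := hκdist j x
    have hdy := hκdist j y
    rw [← hxy] at hdy
    -- A leaf that is not as deep as `h j` is its own cluster, and injectivity of `T.leaf` gives `x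
    -- = y`.
    by_cases hcase : h j ≤ G.dist ρ (T.leaf x)
    · rw [hlen _ _ hc] at hlt
      refine hlt.trans_le ?_
      rw [← zpow_one_add₀ (by norm_num), ← zpow_natCast]
      refine zpow_le_zpow_right₀ (by norm_num) ?_
      have h3 : h j = max 1 (j₀ + 1 - j).toNat := rfl
      change 1 + (j₀ - (G.dist ρ (κ j x) : ℤ)) ≤ j
      omega
    · have h1 : κ j x = T.leaf x := ancestor_eq_self (by omega)
      have h2 : κ j y = T.leaf y := ancestor_eq_self (by omega)
      have hxy' : x = y := T.leaf_bijOn.injOn hx hy (h1.symm.trans (hxy.trans h2))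
      rw [hxy', dist_self]
      positivity
  · intro j i A hne hA
    have hside : ∀ x ∈ I.terminals, ∀ y ∈ I.terminals, κ j x ≠ κ j y → κ j x = A →
        T.leaf x ∈ subtree G ρ A ∧ T.leaf y ∉ subtree G ρ A := by
      rintro x hx y hy hxy rfl
      have hdx := hκdist j x
      constructor
      · refine ⟨by omega, ?_⟩
        have hsub : G.dist ρ (T.leaf x) - min (h j) (G.dist ρ (T.leaf x)) =
            G.dist ρ (T.leaf x) - h j := by omega
        rw [hdx, ancestor, hsub]
        rfl
      · rintro ⟨hd, hanc⟩
        -- If `A` is at full depth, `y` below `A` would share the cluster of `x`. Otherwise `A` is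
        -- the leaf of `x`, and a different leaf below it would give it a child.
        by_cases hcase : h j ≤ G.dist ρ (T.leaf x)
        · refine hxy ?_
          rw [← hanc, hdx, min_eq_left hcase]
        · have h1 : κ j x = T.leaf x := ancestor_eq_self (by omega)
          rw [h1] at hd hanc
          rcases hd.eq_or_lt with heq | hlt
          · rw [ancestor_eq_self heq.ge] at hanc
            exact hxy (by simp only [hκ, hanc])
          · have hd' := dist_ancestor hG ρ (G.dist ρ (T.leaf x) + 1) (T.leaf y)
            refine hleaf x hx (ancestor G ρ (G.dist ρ (T.leaf x) + 1) (T.leaf y)) ?_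
            have hc := isChild_parent hG (root := ρ)
              (z := ancestor G ρ (G.dist ρ (T.leaf x) + 1) (T.leaf y))
              (ne_root_of_dist_pos (G := G) (by omega))
            have hpar : parent G ρ (ancestor G ρ (G.dist ρ (T.leaf x) + 1) (T.leaf y)) =
                T.leaf x := by
              rw [← hanc]
              unfold ancestor
              rw [← Function.iterate_succ_apply' (parent G ρ)]
              congr 2
              have hdl := dist_ancestor hG ρ (G.dist ρ (T.leaf x)) (T.leaf y)
              unfold ancestor at hanc
              rw [hanc]
              omega
            rwa [hpar] at hc
    have hcross : ¬(T.leaf (I.src i) ∈ subtree G ρ A ↔ T.leaf (I.tgt i) ∈ subtree G ρ A) := by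
      rcases hA with hA | hA
      · have := hside _ (I.src_mem i) _ (I.tgt_mem i) hne hA
        tauto
      · have := hside _ (I.tgt_mem i) _ (I.src_mem i) hne.symm hA
        tauto
    refine ((hH i).le_countP_crosses_of_ne hcross).trans ?_
    rw [Multiset.countP_eq_card_filter, Multiset.count, Multiset.countP_eq_card_filter]
    refine Multiset.card_le_card (Multiset.le_filter.2 ⟨Multiset.filter_le _ _, fun e he => ?_⟩)
    obtain ⟨he1, he2⟩ := Multiset.mem_filter.1 he
    exact (eq_of_crosses_subtree hG (hHT e he1) he2).symm

/-- As for `I.opt`, the infimum must range over a nonempty set; the finite tree with every edge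
bought `∑ i, I.req i` times is feasible. -/
theorem Instance.exists_tree_feasible {V : Type*} [MetricSpace V] (I : Instance V)
    (T : HST I.terminals) : ∃ H : Multiset (Sym2 T.Node), (∀ e ∈ H, e ∈ T.graph.edgeSet) ∧
      ∀ i, HasDisjointPaths H (T.leaf (I.src i)) (T.leaf (I.tgt i)) (I.req i) := by
  classical
  have := T.finite
  have := Fintype.ofFinite T.Node
  refine ⟨(∑ i, I.req i) • T.graph.edgeFinset.val, fun e he => ?_, fun i => ?_⟩
  · have := Multiset.mem_of_mem_nsmul he
    simpa using this
  · refine hasDisjointPaths_of_reflTransGen (K := T.graph.edgeFinset.val) ?_ fun e he => ?_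
    · have hr := (SimpleGraph.reachable_iff_reflTransGen _ _).1
        (T.isTree.connected.preconnected (T.leaf (I.src i)) (T.leaf (I.tgt i)))
      exact Relation.ReflTransGen.mono (fun a b hab => Or.inr (by simpa using hab)) _ _ hr
    · rw [Multiset.count_nsmul, Multiset.count_eq_one_of_mem T.graph.edgeFinset.nodup he, mul_one]
      exact Finset.single_le_sum (f := I.req) (fun _ _ => Nat.zero_le _) (Finset.mem_univ i)

theorem Instance.algCost_le_treeOpt {V : Type*} [MetricSpace V]
    (hsep : ∀ u v : V, u ≠ v → 1 ≤ dist u v) (I : Instance V) (T : HST I.terminals) :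
    I.algCost networkAlgorithm ≤ 192 * I.treeOpt T := by
  rw [← div_le_iff₀' (by norm_num)]
  obtain ⟨H₀, hH₀, hH₀'⟩ := I.exists_tree_feasible T
  refine le_csInf ⟨_, H₀, hH₀, hH₀', rfl⟩ ?_
  rintro _ ⟨H, hHT, hH, rfl⟩
  rw [div_le_iff₀' (by norm_num)]
  have hnn := T.cost_nonneg hHT
  rcases Nat.eq_zero_or_pos I.n with hn | hn
  · rw [I.algCost_of_n_eq_zero hn]
    positivity
  · have := I.algCost_le_of_tree_feasible hsep hn T hHT hH
    linarith

end SteinerNetwork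

end

theorem theorem1 :
    ∃ C : ℝ, 0 < C ∧
      ∀ (V : Type*) [MetricSpace V], (∀ u v : V, u ≠ v → 1 ≤ dist u v) →
        ∀ I : SteinerNetwork.Instance V,
          I.Maintains SteinerNetwork.networkAlgorithm ∧
          I.algCost SteinerNetwork.networkAlgorithm ≤ C * Real.log I.k * I.opt ∧
          ∀ T : SteinerNetwork.HST I.terminals,
            I.algCost SteinerNetwork.networkAlgorithm ≤ C * I.treeOpt T :=
  ⟨192, by norm_num, fun _ _ hsep I => ⟨I.maintains_networkAlgorithm hsep,
    I.algCost_le_opt hsep, I.algCost_le_treeOpt hsep⟩⟩
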